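/- Let $\phi\in\mathcal S(\mathbb R^n)$ be a real-valued Schwartz function with $\int_{\mathbb R^n}\phi(x)\,dx=1$, and for $s>0$ let $\phi_s(x):=s^{-n}\phi(x/s)$ and $\Phi_sf:=\phi_s*f$. For a sequence $\{t_i\}_{i\in\mathbb N}\subset(0,\infty)$ decreasing to zero, let $$\mathcal O_{\{t_i\}}(\{\Phi_s\}_{s>0},f)(x):=\Big(\sum_{i=1}^\infty\ \sup_{t_{i+1}\le\varepsilon_{i+1}<\varepsilon_i\le t_i}|\Phi_{\varepsilon_i}f(x)-\Phi_{\varepsilon_{i+1}}f(x)|^2\Big)^{1/2}\in[0,\infty],$$ the supremum of the empty set being $0$. For $f\in L^1_{\mathrm{loc}}(\mathbb R^n)$ (real-valued) let $$\|f\|_{\mathrm{BMO}(\mathbb R^n)}:=\sup_B\frac1{|B|}\int_B|f(x)-f_B|\,dx,\qquad f_B:=\frac1{|B|}\int_Bf(x)\,dx,$$ the supremum being taken over all balls $B\subset\mathbb R^n$, and let $\mathrm{BMO}(\mathbb R^n)$ be the set of those $f\in L^1_{\mathrm{loc}}(\mathbb R^n)$ with $\|f\|_{\mathrm{BMO}(\mathbb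 R^n)}<\infty$. Then the oscillation operator is bounded on $\mathrm{BMO}(\mathbb R^n)$: there is a constant $C>0$, depending only on $n$ and $\phi$, such that for every sequence $\{t_i\}_{i\in\mathbb N}\subset(0,\infty)$ decreasing to zero and every $f\in\mathrm{BMO}(\mathbb R^n)$, the integrals defining $\Phi_sf(x)$ converge absolutely for all $s>0$ and $x\in\mathbb R^n$, $\mathcal O_{\{t_i\}}(\{\Phi_s\}_{s>0},f)(x)<\infty$ for almost every $x\in\mathbb R^n$, the function $\mathcal O_{\{t_i\}}(\{\Phi_s\}_{s>0},f)$ belongs to $\mathrm{BMO}(\mathbb R^n)$, and $$\|\mathcal O_{\{t_i\}}(\{\Phi_s\}_{s>0},f)\|_{\mathrm{BMO}(\mathbb R^n)}\le C\,\|f\|_{\mathrm{BMO}(\mathbb R^n)}.$$ -/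

import Mathlib

open MeasureTheory Filter Topology Metric Set
open scoped ENNReal NNReal SchwartzMap Convolution

noncomputable section

/-- The `BMO` seminorm `sup_B (1/|B|) ∫_B |f - f_B|`, the supremum running over all balls `B` of
`ℝⁿ`, with values in `[0, ∞]`. -/
def bmoNorm {n : ℕ} (f : EuclideanSpace ℝ (Fin n) → ℝ) : ℝ≥0∞ :=
  ⨆ (c : EuclideanSpace ℝ (Fin n)) (r : ℝ) (_ : 0 < r),
    (volume (ball c r))⁻¹ * ∫⁻ x in ball c r, ‖f x - ⨍ y in ball c r, f y‖ₑ

/-- `f ∈ BMO(ℝⁿ)`: `f` is locally integrable with finite `BMO` seminorm. -/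
def MemBMO {n : ℕ} (f : EuclideanSpace ℝ (Fin n) → ℝ) : Prop :=
  LocallyIntegrable f ∧ bmoNorm f < ∞

/-- The dilate `φ_t(x) = t⁻ⁿ φ(x / t)`. -/
def dilate {n : ℕ} (φ : EuclideanSpace ℝ (Fin n) → ℝ) (t : ℝ) (x : EuclideanSpace ℝ (Fin n)) : ℝ :=
  (t ^ n)⁻¹ * φ (t⁻¹ • x)

/-- The convolution operator `Φ_t f = φ_t * f`. -/
def convOp {n : ℕ} (φ : EuclideanSpace ℝ (Fin n) → ℝ) (t : ℝ)
    (f : EuclideanSpace ℝ (Fin n) → ℝ) : EuclideanSpace ℝ (Fin n) → ℝ :=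
  dilate φ t ⋆[ContinuousLinearMap.lsmul ℝ ℝ, volume] f

/-- The oscillation operator
`(∑_i sup_{t_{i+1} ≤ δ < ε ≤ t_i} |T_ε f(x) - T_δ f(x)|²)^{1/2}`, with values in `[0, ∞]`, of a
family `T` of operators along the sequence `t` (indexed from `0`). -/
def oscillationOp {n : ℕ}
    (T : ℝ → (EuclideanSpace ℝ (Fin n) → ℝ) → EuclideanSpace ℝ (Fin n) → ℝ) (t : ℕ → ℝ)
    (f : EuclideanSpace ℝ (Fin n) → ℝ) (x : EuclideanSpace ℝ (Fin n)) : ℝ≥0∞ :=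
  (∑' i : ℕ, ⨆ (ε : ℝ) (δ : ℝ) (_ : t (i + 1) ≤ δ ∧ δ < ε ∧ ε ≤ t i),
    ‖T ε f x - T δ f x‖ₑ ^ 2) ^ (1 / 2 : ℝ)

end

/-! Fix a ball B = B(c, r), let m be the mean of f over 2B and write f = m + f₂ + f₃ with f₂ = (f -
m) 1_{2B}. Since `φ` has integral 1, each Φ_s fixes the constant m, which therefore drops out of
every increment Φ_ε f - Φ_δ f. The oscillation is an ℓ² norm of suprema of increments, hence
subadditive in f (`oscSeq_le_add`). With a = O(f₃)(c), the difference between O(f)(x) and a is thus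
at most O(f₂)(x) plus the oscillation of s ↦ Φ_s f₃(x) - Φ_s f₃(c). It remains to bound the mean of
the first term and the supremum of the second over B by a multiple of the BMO seminorm, and to see
that a is finite.

The far term is pointwise. The mixed increments of the kernel are dominated by U(δ) - U(ε) for a
bounded decreasing U (`exists_dilate_mixed_sub_le`), so the ℓ² sum telescopes
(`oscSeq_le_of_telescoping`) and leaves r ∫ |f₃(y)| (2r + |c - y|)^{-(n+1)} dy, which BMO controls
because means over successive dyadic balls drift at most linearly. Finiteness of a comes from a
cruder telescoping bound that depends on the sequence.

The local term uses Cauchy–Schwarz, the L² bound `exists_lintegral_oscillation_sq_le` and the L²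
John–Nirenberg inequality `lintegral_sq_sub_average_le`. For the L² bound on one block [b, a] of
scales, put g = Φ_b f - Φ_a f and w = f - g. All Φ_s g are dominated by the maximal function of g.
Subtracting g removes the frequencies between 1/a and 1/b, so the multiplier of Φ_σ w - Φ_a f is O(u
/ (1 + u)²) with u = σ|ξ|; the same holds for σ ∂_σ Φ_σ w. The supremum over σ is then reached by
integrating the derivative of a square. By Plancherel each block costs at most a constant times the
integral of |f̂(ξ)|² ((1 + b|ξ|)⁻¹ - (1 + a|ξ|)⁻¹), and these weights telescope over the blocks to
at most 1. -/

/-! ### Volumes of balls -/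

section Balls

variable {n : ℕ}

local notation "𝔼" => EuclideanSpace ℝ (Fin n)

lemma volume_ball_eq (c : 𝔼) {r : ℝ} (hr : 0 < r) :
    volume (ball c r) = ENNReal.ofReal (r ^ n) * volume (ball (0 : 𝔼) 1) := by
  rw [Measure.addHaar_ball_of_pos _ _ hr, finrank_euclideanSpace_fin]

lemma volume_ball_mul (c c' : 𝔼) {r a : ℝ} (hr : 0 < r) (ha : 0 < a) :
    volume (ball c (a * r)) = ENNReal.ofReal (a ^ n) * volume (ball c' r) := by
  rw [volume_ball_eq c (mul_pos ha hr), volume_ball_eq c' hr, mul_pow,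
    ENNReal.ofReal_mul (by positivity), mul_assoc]

lemma volume_ball_ne_zero (c : 𝔼) {r : ℝ} (hr : 0 < r) : volume (ball c r) ≠ 0 :=
  (measure_ball_pos _ _ hr).ne'

lemma volume_ball_ne_top (c : 𝔼) {r : ℝ} : volume (ball c r) ≠ ∞ := measure_ball_lt_top.ne

lemma integrableOn_ball {f : 𝔼 → ℝ} (hf : LocallyIntegrable f) (c : 𝔼) (r : ℝ) :
    IntegrableOn f (ball c r) :=
  (hf.integrableOn_isCompact (isCompact_closedBall c r)).mono_set ball_subset_closedBall

lemma ball_ae_eq_closedBall (c : 𝔼) {r : ℝ} (hr : 0 < r) :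
    (ball c r : Set 𝔼) =ᵐ[volume] closedBall c r := by
  rw [← ball_union_sphere]
  exact (union_ae_eq_left_of_ae_eq_empty
    (ae_eq_empty.2 (Measure.addHaar_sphere_of_ne_zero _ _ hr.ne'))).symm

end Balls

/-! ### Mean values and deviations from a constant -/

section Averages

lemma enorm_average_sub_mul_le {α : Type*} [MeasurableSpace α] {μ : Measure α} {s : Set α}
    (hs : μ s ≠ ∞) (hs0 : μ s ≠ 0) {f : α → ℝ} (hf : IntegrableOn f s μ) (c : ℝ) :
    ‖(⨍ y in s, f y ∂μ) - c‖ₑ * μ s ≤ ∫⁻ x in s, ‖f x - c‖ₑ ∂μ := by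
  have hpos : 0 < μ.real s := ENNReal.toReal_pos hs0 hs
  have hsub : ∫ x in s, (f x - c) ∂μ = μ.real s * ((⨍ y in s, f y ∂μ) - c) := by
    rw [integral_sub hf (integrableOn_const hs), setAverage_eq]
    simp only [integral_const, measureReal_restrict_apply_univ, smul_eq_mul]
    field_simp
  have h := enorm_integral_le_lintegral_enorm (μ := μ.restrict s) (fun x => f x - c)
  rw [hsub, enorm_mul, mul_comm] at h
  refine le_trans (le_of_eq ?_) h
  congr 1
  rw [Real.enorm_eq_ofReal hpos.le, Measure.real, ENNReal.ofReal_toReal hs]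

lemma lintegral_enorm_sub_const_le {α : Type*} [MeasurableSpace α] {μ : Measure α} (s : Set α)
    (f : α → ℝ) (b c : ℝ) :
    ∫⁻ x in s, ‖f x - b‖ₑ ∂μ ≤ ∫⁻ x in s, ‖f x - c‖ₑ ∂μ + ‖c - b‖ₑ * μ s := by
  calc ∫⁻ x in s, ‖f x - b‖ₑ ∂μ ≤ ∫⁻ x in s, (‖f x - c‖ₑ + ‖c - b‖ₑ) ∂μ := by
        refine lintegral_mono fun x => ?_
        have : f x - b = (f x - c) + (c - b) := by ring
        rw [this]; exact enorm_add_le _ _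
    _ = _ := by rw [lintegral_add_right _ measurable_const, setLIntegral_const]

lemma lintegral_enorm_sub_average_le {α : Type*} [MeasurableSpace α] {μ : Measure α} {s : Set α}
    (hs : μ s ≠ ∞) (hs0 : μ s ≠ 0) {f : α → ℝ} (hf : IntegrableOn f s μ) (c : ℝ) :
    ∫⁻ x in s, ‖f x - ⨍ y in s, f y ∂μ‖ₑ ∂μ ≤ 2 * ∫⁻ x in s, ‖f x - c‖ₑ ∂μ := by
  refine (lintegral_enorm_sub_const_le s f _ c).trans ?_
  rw [two_mul, enorm_sub_rev]
  gcongr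
  exact enorm_average_sub_mul_le hs hs0 hf c

end Averages

/-! ### BMO: comparison of means and the weighted tail integral -/

section BMO

variable {n : ℕ}

local notation "𝔼" => EuclideanSpace ℝ (Fin n)

lemma lintegral_oscillation_le_bmoNorm (f : 𝔼 → ℝ) (c : 𝔼) {r : ℝ} (hr : 0 < r) :
    ∫⁻ x in ball c r, ‖f x - ⨍ y in ball c r, f y‖ₑ ≤ bmoNorm f * volume (ball c r) := by
  rw [mul_comm, ← ENNReal.inv_mul_le_iff (volume_ball_ne_zero c hr) (volume_ball_ne_top c)]
  exact le_iSup_of_le c (le_iSup_of_le r (le_iSup_of_le hr le_rfl))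

/-- Replacing the mean by an arbitrary constant costs a factor 2, so the mean of the oscillation
over a ball never has to be computed. -/
lemma bmoNorm_le_of_forall_ball {f : 𝔼 → ℝ} (hf : LocallyIntegrable f) {K : ℝ≥0∞}
    (h : ∀ (c : 𝔼) (r : ℝ), 0 < r → ∃ a : ℝ,
      ∫⁻ x in ball c r, ‖f x - a‖ₑ ≤ K * volume (ball c r)) :
    bmoNorm f ≤ 2 * K := by
  refine iSup_le fun c => iSup_le fun r => iSup_le fun hr => ?_
  obtain ⟨a, ha⟩ := h c r hr
  rw [ENNReal.inv_mul_le_iff (volume_ball_ne_zero c hr) (volume_ball_ne_top c)]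
  refine (lintegral_enorm_sub_average_le (volume_ball_ne_top c) (volume_ball_ne_zero c hr)
    (integrableOn_ball hf c r) a).trans ?_
  calc _ ≤ 2 * (K * volume (ball c r)) := by gcongr
    _ = _ := by ring

lemma lintegral_sub_average_le_of_subset {f : 𝔼 → ℝ} (hf : LocallyIntegrable f) {c c' : 𝔼}
    {r a : ℝ} (hr : 0 < r) (ha : 0 < a) (hsub : ball c r ⊆ ball c' (a * r)) :
    ‖(⨍ y in ball c r, f y) - ⨍ y in ball c' (a * r), f y‖ₑ ≤
      bmoNorm f * ENNReal.ofReal (a ^ n) := by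
  have h1 := enorm_average_sub_mul_le (volume_ball_ne_top c) (volume_ball_ne_zero c hr)
    (integrableOn_ball hf c r) (⨍ y in ball c' (a * r), f y)
  have h2 := h1.trans ((lintegral_mono_set hsub).trans
    (lintegral_oscillation_le_bmoNorm f c' (mul_pos ha hr)))
  rw [volume_ball_mul c' c hr ha, ← mul_assoc] at h2
  exact (ENNReal.mul_le_mul_iff_left (volume_ball_ne_zero c hr) (volume_ball_ne_top c)).1 h2

lemma lintegral_ball_mul_sub_average_le {f : 𝔼 → ℝ} (hf : LocallyIntegrable f) (c : 𝔼)
    {r a : ℝ} (hr : 0 < r) (ha : 1 ≤ a) :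
    ∫⁻ x in ball c (a * r), ‖f x - ⨍ y in ball c r, f y‖ₑ ≤
      2 * bmoNorm f * ENNReal.ofReal (a ^ n) * volume (ball c (a * r)) := by
  have ha0 : 0 < a := by linarith
  refine (lintegral_enorm_sub_const_le _ f _ (⨍ y in ball c (a * r), f y)).trans ?_
  have h1 := lintegral_oscillation_le_bmoNorm f c (mul_pos ha0 hr)
  have h2 := lintegral_sub_average_le_of_subset hf (c := c) (c' := c) hr ha0
    (ball_subset_ball (by nlinarith))
  rw [enorm_sub_rev] at h2
  have h3 : bmoNorm f ≤ bmoNorm f * ENNReal.ofReal (a ^ n) := by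
    refine le_mul_of_one_le_right' ?_
    rw [ENNReal.one_le_ofReal]; exact one_le_pow₀ ha
  calc _ ≤ bmoNorm f * ENNReal.ofReal (a ^ n) * volume (ball c (a * r)) +
      bmoNorm f * ENNReal.ofReal (a ^ n) * volume (ball c (a * r)) := by
        gcongr
        exact h1.trans (by gcongr)
    _ = _ := by ring

lemma enorm_average_pow_two_mul_sub_le {f : 𝔼 → ℝ} (hf : LocallyIntegrable f) (c : 𝔼)
    {r : ℝ} (hr : 0 < r) (k : ℕ) :
    ‖(⨍ y in ball c (2 ^ k * r), f y) - ⨍ y in ball c r, f y‖ₑ ≤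
      k * (bmoNorm f * ENNReal.ofReal (2 ^ n)) := by
  induction k with
  | zero => simp
  | succ k ih =>
    have hk : 0 < 2 ^ k * r := by positivity
    have h := lintegral_sub_average_le_of_subset hf (c := c) (c' := c) hk two_pos
      (ball_subset_ball (by linarith))
    have e : (2 : ℝ) * (2 ^ k * r) = 2 ^ (k + 1) * r := by ring
    rw [e, enorm_sub_rev] at h
    have : (⨍ y in ball c (2 ^ (k + 1) * r), f y) - ⨍ y in ball c r, f y =
      ((⨍ y in ball c (2 ^ (k + 1) * r), f y) - ⨍ y in ball c (2 ^ k * r), f y) +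
      ((⨍ y in ball c (2 ^ k * r), f y) - ⨍ y in ball c r, f y) := by ring
    rw [this]
    refine (enorm_add_le _ _).trans ((add_le_add h ih).trans (le_of_eq ?_))
    push_cast; ring

/-- One term suffices, that of the least k with |y - c| < 2^k r: minimality gives 2^k r ≤ 2 (r + |y
- c|), whence the factor 2^m. -/
lemma inv_pow_le_tsum_indicator (c : 𝔼) {r : ℝ} (hr : 0 < r) (m : ℕ) (y : 𝔼) :
    ENNReal.ofReal (((r + ‖y - c‖) ^ m)⁻¹) ≤
      ∑' k : ℕ, ENNReal.ofReal (2 ^ m * ((2 ^ k * r) ^ m)⁻¹) *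
        (ball c (2 ^ k * r)).indicator (fun _ => 1) y := by
  have hex : ∃ k : ℕ, ‖y - c‖ < 2 ^ k * r := by
    obtain ⟨k, hk⟩ := pow_unbounded_of_one_lt (‖y - c‖ / r) (one_lt_two)
    exact ⟨k, by rwa [div_lt_iff₀ hr] at hk⟩
  classical
  set k := Nat.find hex with hkdef
  have hk : ‖y - c‖ < 2 ^ k * r := Nat.find_spec hex
  refine le_trans ?_ (ENNReal.le_tsum k)
  rw [indicator_of_mem (by simpa [dist_eq_norm] using hk), mul_one]
  refine ENNReal.ofReal_le_ofReal ?_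
  have key : 2 ^ k * r ≤ 2 * (r + ‖y - c‖) := by
    rcases Nat.eq_zero_or_pos k with h0 | h0
    · rw [h0]; simp; nlinarith [norm_nonneg (y - c)]
    · have := Nat.find_min hex (m := k - 1) (by omega)
      obtain ⟨j, hj⟩ : ∃ j, k = j + 1 := ⟨k - 1, by omega⟩
      rw [hj] at this ⊢
      simp only [Nat.add_sub_cancel, not_lt] at this
      rw [pow_succ]; nlinarith
  have h1 : (2 ^ k * r) ^ m ≤ 2 ^ m * (r + ‖y - c‖) ^ m := by
    rw [← mul_pow]; gcongr
  have p1 : 0 < (2 ^ k * r) ^ m := by positivity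
  have p2 : 0 < (r + ‖y - c‖) ^ m := by positivity
  rw [inv_le_iff_one_le_mul₀ p2, ← div_eq_mul_inv, div_mul_eq_mul_div, one_le_div p1]
  exact h1

lemma lintegral_mul_inv_pow_le (h : 𝔼 → ℝ≥0∞) (hh : AEMeasurable h) (c : 𝔼) {r : ℝ} (hr : 0 < r)
    (m : ℕ) :
    ∫⁻ y, h y * ENNReal.ofReal (((r + ‖y - c‖) ^ m)⁻¹) ≤
      ∑' k : ℕ, ENNReal.ofReal (2 ^ m * ((2 ^ k * r) ^ m)⁻¹) * ∫⁻ y in ball c (2 ^ k * r), h y := by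
  calc _ ≤ ∫⁻ y, ∑' k : ℕ, ENNReal.ofReal (2 ^ m * ((2 ^ k * r) ^ m)⁻¹) *
        (ball c (2 ^ k * r)).indicator h y := by
        refine lintegral_mono fun y => ?_
        refine (mul_le_mul_right (inv_pow_le_tsum_indicator c hr m y) _).trans ?_
        rw [← ENNReal.tsum_mul_left]
        refine ENNReal.tsum_le_tsum fun k => le_of_eq ?_
        classical
        rw [indicator_apply, indicator_apply]
        split_ifs
        · rw [mul_one, mul_comm]
        · simp only [mul_zero]
    _ = _ := by
        rw [lintegral_tsum fun k => (hh.indicator measurableSet_ball).const_mul _]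
        congr 1; ext k
        rw [lintegral_const_mul'' _ (hh.indicator measurableSet_ball),
          lintegral_indicator measurableSet_ball]

/-- The constant in `lintegral_sub_average_mul_inv_pow_le`. -/
noncomputable def bmoTailConst (n : ℕ) : ℝ≥0∞ :=
  ∑' k : ℕ, ENNReal.ofReal (2 ^ (n + 1) * (1 / 2) ^ k) *
    ((1 + k * ENNReal.ofReal (2 ^ n)) * volume (ball (0 : EuclideanSpace ℝ (Fin n)) 1))

lemma bmoTailConst_ne_top : bmoTailConst n ≠ ∞ := by
  have e : ∀ k : ℕ, ENNReal.ofReal (2 ^ (n + 1) * (1 / 2) ^ k) *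
    ((1 + k * ENNReal.ofReal (2 ^ n)) * volume (ball (0 : 𝔼) 1)) =
    ENNReal.ofReal (2 ^ (n + 1) * (1 / 2) ^ k * (1 + k * 2 ^ n)) * volume (ball (0 : 𝔼) 1) := by
    intro k
    rw [ENNReal.ofReal_mul (p := 2 ^ (n + 1) * (1 / 2) ^ k) (by positivity),
      ENNReal.ofReal_add zero_le_one (by positivity), ENNReal.ofReal_one,
      ENNReal.ofReal_mul (p := (k : ℝ)) (by positivity), ENNReal.ofReal_natCast, mul_assoc]
  simp_rw [bmoTailConst, e]
  rw [ENNReal.tsum_mul_right]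
  refine ENNReal.mul_ne_top ?_ (volume_ball_ne_top _)
  refine Summable.tsum_ofReal_ne_top ?_
  have h0 : Summable fun k : ℕ => (1 / 2 : ℝ) ^ k := summable_geometric_two
  have h1 : Summable fun k : ℕ => (k : ℝ) * (1 / 2 : ℝ) ^ k := by
    simpa using summable_pow_mul_geometric_of_norm_lt_one 1 (r := (1 / 2 : ℝ)) (by norm_num)
  have := (h0.mul_left (2 ^ (n + 1))).add (h1.mul_left (2 ^ (n + 1) * 2 ^ n))
  refine this.congr fun k => ?_
  ring

/-- On the k-th dyadic ball the mean of |f - m| grows linearly in k, since each doubling moves the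
mean by a bounded amount, while weight times volume decays like 2^{-k} / r. -/
lemma lintegral_sub_average_mul_inv_pow_le {f : 𝔼 → ℝ} (hf : LocallyIntegrable f) (c : 𝔼)
    {r : ℝ} (hr : 0 < r) :
    ∫⁻ y, ‖f y - ⨍ z in ball c r, f z‖ₑ * ENNReal.ofReal (((r + ‖y - c‖) ^ (n + 1))⁻¹) ≤
      bmoTailConst n * ENNReal.ofReal r⁻¹ * bmoNorm f := by
  have hm : AEMeasurable fun y => ‖f y - ⨍ z in ball c r, f z‖ₑ :=
    (hf.aestronglyMeasurable.sub aestronglyMeasurable_const).enorm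
  refine (lintegral_mul_inv_pow_le _ hm c hr (n + 1)).trans ?_
  rw [bmoTailConst, ← ENNReal.tsum_mul_right, ← ENNReal.tsum_mul_right]
  refine ENNReal.tsum_le_tsum fun k => ?_
  have hk : (0 : ℝ) < 2 ^ k * r := by positivity
  have h1 : ∫⁻ y in ball c (2 ^ k * r), ‖f y - ⨍ z in ball c r, f z‖ₑ ≤
      (1 + k * ENNReal.ofReal (2 ^ n)) * bmoNorm f * volume (ball c (2 ^ k * r)) := by
    refine (lintegral_enorm_sub_const_le _ f _ (⨍ y in ball c (2 ^ k * r), f y)).trans ?_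
    calc _ ≤ bmoNorm f * volume (ball c (2 ^ k * r)) +
          k * (bmoNorm f * ENNReal.ofReal (2 ^ n)) * volume (ball c (2 ^ k * r)) := by
          gcongr
          · exact lintegral_oscillation_le_bmoNorm f c hk
          · exact enorm_average_pow_two_mul_sub_le hf c hr k
      _ = _ := by ring
  refine (mul_le_mul_right h1 _).trans (le_of_eq ?_)
  rw [volume_ball_eq c hk]
  have e : ENNReal.ofReal (2 ^ (n + 1) * ((2 ^ k * r) ^ (n + 1))⁻¹) *
      ENNReal.ofReal ((2 ^ k * r) ^ n) =
      ENNReal.ofReal (2 ^ (n + 1) * (1 / 2) ^ k) * ENNReal.ofReal r⁻¹ := by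
    rw [← ENNReal.ofReal_mul (by positivity), ← ENNReal.ofReal_mul (by positivity)]
    congr 1
    rw [pow_succ (2 ^ k * r), one_div, inv_pow]
    field_simp
  calc _ = (ENNReal.ofReal (2 ^ (n + 1) * ((2 ^ k * r) ^ (n + 1))⁻¹) *
      ENNReal.ofReal ((2 ^ k * r) ^ n)) * ((1 + k * ENNReal.ofReal (2 ^ n)) * bmoNorm f *
        volume (ball (0 : 𝔼) 1)) := by ring
    _ = _ := by rw [e]; ring

end BMO

/-! ### Vitali covering and the Hardy–Littlewood maximal theorem in L² -/

section Maximal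

variable {n : ℕ}

local notation "𝔼" => EuclideanSpace ℝ (Fin n)

lemma exists_countable_disjoint_balls_cover (t : Set (𝔼 × ℝ)) (R : ℝ)
    (ht : ∀ p ∈ t, 0 < p.2 ∧ p.2 ≤ R) :
    ∃ u ⊆ t, u.Countable ∧ (u.PairwiseDisjoint fun p => ball p.1 p.2) ∧
      ∀ p ∈ t, ∃ q ∈ u, ball p.1 p.2 ⊆ ball q.1 (5 * q.2) := by
  -- Any factor above 3 works for closed balls; 4 leaves room to pass to open balls of factor 5.
  obtain ⟨u, hut, hdis, hcov⟩ := Vitali.exists_disjoint_subfamily_covering_enlargement_closedBall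
    t Prod.fst Prod.snd R (fun p hp => (ht p hp).2) 4 (by norm_num)
  have hdis' : u.PairwiseDisjoint fun p => ball p.1 p.2 :=
    hdis.mono fun p => ball_subset_closedBall
  refine ⟨u, hut, ?_, hdis', fun p hp => ?_⟩
  · exact hdis'.countable_of_isOpen (fun _ _ => isOpen_ball)
      fun p hp => nonempty_ball.2 (ht p (hut hp)).1
  · obtain ⟨q, hq, hsub⟩ := hcov p hp
    refine ⟨q, hq, ball_subset_closedBall.trans (hsub.trans (closedBall_subset_ball ?_))⟩
    linarith [(ht q (hut hq)).1]

lemma mul_tsum_volume_ball_le {u : Set (𝔼 × ℝ)} (hu : u.Countable)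
    (hdis : u.PairwiseDisjoint fun p => ball p.1 p.2) {h : 𝔼 → ℝ≥0∞} {S : Set 𝔼} {a : ℝ≥0∞}
    (hS : ∀ p ∈ u, ball p.1 p.2 ⊆ S)
    (ha : ∀ p ∈ u, a * volume (ball p.1 p.2) ≤ ∫⁻ x in ball p.1 p.2, h x) :
    a * ∑' p : u, volume (ball p.1.1 p.1.2) ≤ ∫⁻ x in S, h x := by
  rw [← ENNReal.tsum_mul_left]
  calc ∑' p : u, a * volume (ball p.1.1 p.1.2) ≤ ∑' p : u, ∫⁻ x in ball p.1.1 p.1.2, h x :=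
        ENNReal.tsum_le_tsum fun p => ha p.1 p.2
    _ = ∫⁻ x in ⋃ p ∈ u, ball p.1 p.2, h x :=
        (lintegral_biUnion hu (fun _ _ => measurableSet_ball) hdis h).symm
    _ ≤ _ := lintegral_mono_set (iUnion₂_subset hS)

/-- The uncentred Hardy–Littlewood maximal function. -/
noncomputable def maximalFn (h : 𝔼 → ℝ≥0∞) (x : 𝔼) : ℝ≥0∞ :=
  ⨆ (c : 𝔼) (r : ℝ) (_ : 0 < r) (_ : x ∈ ball c r),
    (volume (ball c r))⁻¹ * ∫⁻ y in ball c r, h y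

lemma lintegral_ball_le_maximalFn (h : 𝔼 → ℝ≥0∞) (c : 𝔼) {r : ℝ} (hr : 0 < r) :
    ∫⁻ y in ball c r, h y ≤ maximalFn h c * volume (ball c r) := by
  rw [mul_comm, ← ENNReal.inv_mul_le_iff (volume_ball_ne_zero c hr) (volume_ball_ne_top c)]
  exact le_iSup_of_le c (le_iSup_of_le r (le_iSup_of_le hr
    (le_iSup_of_le (mem_ball_self hr) le_rfl)))

lemma lt_maximalFn_iff (h : 𝔼 → ℝ≥0∞) (x : 𝔼) (a : ℝ≥0∞) :
    a < maximalFn h x ↔ ∃ (c : 𝔼) (r : ℝ), 0 < r ∧ x ∈ ball c r ∧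
      a < (volume (ball c r))⁻¹ * ∫⁻ y in ball c r, h y := by
  simp only [maximalFn, lt_iSup_iff, exists_prop]

/-- The maximal function is uncentred, so a ball witnessing a large value at x does so at all of its
points: superlevel sets are open. -/
lemma measurable_maximalFn (h : 𝔼 → ℝ≥0∞) : Measurable (maximalFn h) := by
  refine measurable_of_Ioi fun a => IsOpen.measurableSet ?_
  rw [isOpen_iff_forall_mem_open]
  intro x hx
  obtain ⟨c, r, hr, hxb, hlt⟩ := (lt_maximalFn_iff h x a).1 hx
  exact ⟨ball c r, fun y hy => (lt_maximalFn_iff h y a).2 ⟨c, r, hr, hy, hlt⟩, isOpen_ball, hxb⟩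

lemma mul_volume_maximalFn_gt_le (h : 𝔼 → ℝ≥0∞) (a : ℝ≥0∞) :
    a * volume {x | a < maximalFn h x} ≤ ENNReal.ofReal (5 ^ n) * ∫⁻ x, h x := by
  -- The covering lemma needs bounded radii; the cutoff N is removed at the end by monotone
  -- continuity of the measure.
  set t : ℕ → Set (𝔼 × ℝ) := fun N =>
    {p | (0 < p.2 ∧ p.2 ≤ N) ∧ a < (volume (ball p.1 p.2))⁻¹ * ∫⁻ y in ball p.1 p.2, h y} with ht
  have hU : {x | a < maximalFn h x} = ⋃ N, ⋃ p ∈ t N, ball p.1 p.2 := by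
    ext x
    simp only [mem_ofPred_eq, lt_maximalFn_iff, mem_iUnion, ht]
    constructor
    · rintro ⟨c, r, hr, hx, hlt⟩
      obtain ⟨N, hN⟩ := exists_nat_ge r
      exact ⟨N, (c, r), ⟨⟨hr, hN⟩, hlt⟩, hx⟩
    · rintro ⟨N, p, ⟨⟨hr, _⟩, hlt⟩, hx⟩
      exact ⟨p.1, p.2, hr, hx, hlt⟩
  have hmono : Monotone fun N => ⋃ p ∈ t N, ball p.1 p.2 := by
    intro N M hNM
    refine biUnion_mono (fun p hp => ⟨⟨hp.1.1, hp.1.2.trans (by exact_mod_cast hNM)⟩, hp.2⟩)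
      fun _ _ => Subset.rfl
  rw [hU, hmono.measure_iUnion, ENNReal.mul_iSup]
  refine iSup_le fun N => ?_
  obtain ⟨u, hut, hc, hdis, hcov⟩ := exists_countable_disjoint_balls_cover (t N) N
    fun p hp => hp.1
  have hsub : (⋃ p ∈ t N, ball p.1 p.2) ⊆ ⋃ q ∈ u, ball q.1 (5 * q.2) := by
    refine iUnion₂_subset fun p hp => ?_
    obtain ⟨q, hq, hsub⟩ := hcov p hp
    exact hsub.trans (subset_biUnion_of_mem (u := fun q : 𝔼 × ℝ => ball q.1 (5 * q.2)) hq)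
  calc a * volume (⋃ p ∈ t N, ball p.1 p.2)
      ≤ a * ∑' q : u, volume (ball q.1.1 (5 * q.1.2)) := by
        gcongr
        exact (measure_mono hsub).trans (measure_biUnion_le _ hc _)
    _ = ENNReal.ofReal (5 ^ n) * (a * ∑' q : u, volume (ball q.1.1 q.1.2)) := by
        have e : ∀ q : u, volume (ball q.1.1 (5 * q.1.2)) =
            ENNReal.ofReal (5 ^ n) * volume (ball q.1.1 q.1.2) := fun q =>
          volume_ball_mul _ _ (hut q.2).1.1 (by norm_num)
        simp_rw [e]
        rw [ENNReal.tsum_mul_left]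
        ring
    _ ≤ ENNReal.ofReal (5 ^ n) * ∫⁻ x in univ, h x := by
        gcongr
        refine mul_tsum_volume_ball_le hc hdis (fun _ _ => subset_univ _) fun p hp => ?_
        have h2 := (hut hp).2.le
        rwa [← ENNReal.div_eq_inv_mul, ENNReal.le_div_iff_mul_le
          (Or.inl (volume_ball_ne_zero _ (hut hp).1.1)) (Or.inl (volume_ball_ne_top _))] at h2
    _ = _ := by rw [setLIntegral_univ]

/-- As h ≤ h 1_{h > a} + a, a mean of h above 2a forces a mean of the truncation above a. This
localises the weak-type bound to the large values of h. -/
lemma maximalFn_gt_subset (h : 𝔼 → ℝ≥0∞) {a : ℝ≥0∞} (ha : a ≠ ∞) :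
    {x | a + a < maximalFn h x} ⊆ {x | a < maximalFn ({x | a < h x}.indicator h) x} := by
  intro x hx
  obtain ⟨c, r, hr, hxb, hlt⟩ := (lt_maximalFn_iff h x _).1 hx
  refine (lt_maximalFn_iff _ x a).2 ⟨c, r, hr, hxb, ?_⟩
  have h1 : ∫⁻ y in ball c r, h y ≤
      (∫⁻ y in ball c r, {x | a < h x}.indicator h y) + a * volume (ball c r) := by
    rw [← setLIntegral_const, ← lintegral_add_right _ measurable_const]
    refine lintegral_mono fun y => ?_
    by_cases hy : a < h y
    · simp [hy]
    · simp [hy, not_lt.1 hy]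
  have h2 : (volume (ball c r))⁻¹ * ∫⁻ y in ball c r, h y ≤
      (volume (ball c r))⁻¹ * (∫⁻ y in ball c r, {x | a < h x}.indicator h y) + a := by
    refine (mul_le_mul_right h1 _).trans (le_of_eq ?_)
    rw [mul_add, mul_comm a, ← mul_assoc (volume (ball c r))⁻¹, ENNReal.inv_mul_cancel
      (volume_ball_ne_zero c hr) (volume_ball_ne_top c), one_mul]
  exact (ENNReal.add_lt_add_iff_right ha).1 (hlt.trans_le h2)

/-- The layer-cake bound a² ≤ ∫₀^a 2s ds; for a = ∞ it is tested on intervals (0, b) with b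
arbitrarily large. -/
lemma sq_le_lintegral_indicator_lt (a : ℝ≥0∞) :
    a ^ 2 ≤ ∫⁻ s in Ioi (0 : ℝ), {s | ENNReal.ofReal s < a}.indicator
      (fun s => ENNReal.ofReal (2 * s)) s := by
  have key : ∀ b : ℝ, 0 ≤ b → ENNReal.ofReal b ≤ a → ENNReal.ofReal b ^ 2 ≤
      ∫⁻ s in Ioi (0 : ℝ), {s | ENNReal.ofReal s < a}.indicator
        (fun s => ENNReal.ofReal (2 * s)) s := by
    intro b hb hba
    have h1 : ENNReal.ofReal b ^ 2 = ∫⁻ s in Ioo 0 b, ENNReal.ofReal (2 * s) := by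
      have h2 : ∫ s in (0 : ℝ)..b, 2 * s = b ^ 2 := by
        rw [intervalIntegral.integral_const_mul, integral_id]; ring
      rw [← ofReal_integral_eq_lintegral_ofReal, ← integral_Ioc_eq_integral_Ioo,
        ← intervalIntegral.integral_of_le hb, h2, ENNReal.ofReal_pow hb]
      · exact (Continuous.integrableOn_Icc (by fun_prop)).mono_set Ioo_subset_Icc_self
      · filter_upwards [self_mem_ae_restrict measurableSet_Ioo] with s hs
        have := hs.1
        simp only [Pi.zero_apply]; positivity
    rw [h1]
    calc _ = ∫⁻ s in Ioo 0 b, {s | ENNReal.ofReal s < a}.indicator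
            (fun s => ENNReal.ofReal (2 * s)) s := by
          refine setLIntegral_congr_fun measurableSet_Ioo fun s hs => ?_
          rw [indicator_of_mem]
          exact ((ENNReal.ofReal_lt_ofReal_iff (hs.1.trans hs.2)).2 hs.2).trans_le hba
      _ ≤ _ := lintegral_mono_set Ioo_subset_Ioi_self
  rcases eq_or_ne a ∞ with rfl | ha
  · refine top_le_iff.2 (ENNReal.eq_top_of_forall_nnreal_le fun r => ?_) |>.ge
    refine le_trans ?_ (key (r + 1) (by positivity) le_top)
    rw [← ENNReal.ofReal_pow (by positivity), ← ENNReal.ofReal_coe_nnreal]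
    refine ENNReal.ofReal_le_ofReal ?_
    nlinarith [r.2]
  · have := key a.toReal ENNReal.toReal_nonneg (ENNReal.ofReal_toReal ha).le
    rwa [ENNReal.ofReal_toReal ha] at this

/-- The Hardy–Littlewood maximal theorem in `L²`. -/
theorem lintegral_maximalFn_sq_le (h : 𝔼 → ℝ≥0∞) (hh : Measurable h) :
    ∫⁻ x, maximalFn h x ^ 2 ≤ ENNReal.ofReal (8 * 5 ^ n) * ∫⁻ x, h x ^ 2 := by
  have hM := measurable_maximalFn h
  have m1 : Measurable (Function.uncurry fun (x : 𝔼) (s : ℝ) =>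
      {s | ENNReal.ofReal s < maximalFn h x}.indicator (fun s => ENNReal.ofReal (2 * s)) s) := by
    have : MeasurableSet {p : 𝔼 × ℝ | ENNReal.ofReal p.2 < maximalFn h p.1} :=
      measurableSet_lt (by fun_prop) (hM.comp measurable_fst)
    exact Measurable.indicator (f := fun p : 𝔼 × ℝ => ENNReal.ofReal (2 * p.2)) (by fun_prop) this
  have m2 : Measurable (Function.uncurry fun (s : ℝ) (x : 𝔼) =>
      {x | ENNReal.ofReal (s / 2) < h x}.indicator h x) := by
    have : MeasurableSet {p : ℝ × 𝔼 | ENNReal.ofReal (p.1 / 2) < h p.2} :=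
      measurableSet_lt (by fun_prop) (hh.comp measurable_snd)
    exact Measurable.indicator (f := fun p : ℝ × 𝔼 => h p.2) (by fun_prop) this
  calc ∫⁻ x, maximalFn h x ^ 2
      ≤ ∫⁻ x, ∫⁻ s in Ioi (0 : ℝ), {s | ENNReal.ofReal s < maximalFn h x}.indicator
        (fun s => ENNReal.ofReal (2 * s)) s := lintegral_mono fun x => sq_le_lintegral_indicator_lt _
    _ = ∫⁻ s in Ioi (0 : ℝ), ∫⁻ x, {s | ENNReal.ofReal s < maximalFn h x}.indicator
        (fun s => ENNReal.ofReal (2 * s)) s := lintegral_lintegral_swap m1.aemeasurable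
    _ ≤ ∫⁻ s in Ioi (0 : ℝ), ENNReal.ofReal (4 * 5 ^ n) *
          ∫⁻ x, {x | ENNReal.ofReal (s / 2) < h x}.indicator h x := by
        refine setLIntegral_mono' measurableSet_Ioi fun s hs => ?_
        have hs0 : (0 : ℝ) < s := hs
        have e1 : ∀ x, {s | ENNReal.ofReal s < maximalFn h x}.indicator
            (fun s => ENNReal.ofReal (2 * s)) s =
            {x | ENNReal.ofReal s < maximalFn h x}.indicator (fun _ => ENNReal.ofReal (2 * s)) x := by
          intro x; by_cases hx : ENNReal.ofReal s < maximalFn h x <;> simp [hx]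
        simp_rw [e1]
        rw [lintegral_indicator_const (measurableSet_lt measurable_const hM)]
        have e2 : ENNReal.ofReal s = ENNReal.ofReal (s / 2) + ENNReal.ofReal (s / 2) := by
          rw [← ENNReal.ofReal_add (by positivity) (by positivity)]; congr 1; ring
        have hsub := maximalFn_gt_subset h (a := ENNReal.ofReal (s / 2)) ENNReal.ofReal_ne_top
        rw [← e2] at hsub
        -- The weak-type bound is applied at level s / 2 to the truncation of h at that level, hence
        -- 2s = 4 · (s / 2).
        have e3 : ENNReal.ofReal (2 * s) = ENNReal.ofReal 4 * ENNReal.ofReal (s / 2) := by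
          rw [← ENNReal.ofReal_mul (by norm_num)]; congr 1; ring
        rw [e3, mul_assoc, ENNReal.ofReal_mul (by norm_num), mul_assoc]
        refine mul_le_mul_right ?_ _
        exact (mul_le_mul_right (measure_mono hsub) _).trans (mul_volume_maximalFn_gt_le _ _)
    _ = ENNReal.ofReal (4 * 5 ^ n) * ∫⁻ x, ∫⁻ s in Ioi (0 : ℝ),
          {x | ENNReal.ofReal (s / 2) < h x}.indicator h x := by
        have m3 : Measurable fun s : ℝ =>
            ∫⁻ x, {x | ENNReal.ofReal (s / 2) < h x}.indicator h x := m2.lintegral_prod_right'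
        rw [lintegral_const_mul _ m3, lintegral_lintegral_swap m2.aemeasurable]
    _ ≤ ENNReal.ofReal (4 * 5 ^ n) * ∫⁻ x, 2 * h x ^ 2 := by
        gcongr with x
        have e1 : ∀ s, {x | ENNReal.ofReal (s / 2) < h x}.indicator h x =
            {s | ENNReal.ofReal (s / 2) < h x}.indicator (fun _ => h x) s := by
          intro s; by_cases hx : ENNReal.ofReal (s / 2) < h x <;> simp [hx]
        simp_rw [e1]
        rw [lintegral_indicator_const (measurableSet_lt (by fun_prop) measurable_const),
          Measure.restrict_apply (measurableSet_lt (by fun_prop) measurable_const)]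
        have : volume ({s | ENNReal.ofReal (s / 2) < h x} ∩ Ioi 0) ≤ 2 * h x := by
          rcases eq_or_ne (h x) ∞ with hx | hx
          · simp [hx]
          · calc _ ≤ volume (Ioo 0 (2 * (h x).toReal)) := by
                  refine measure_mono fun s hs => ⟨hs.2, ?_⟩
                  have h1 : ENNReal.ofReal (s / 2) < h x := hs.1
                  rw [ENNReal.ofReal_lt_iff_lt_toReal (by have : 0 < s := hs.2; positivity) hx] at h1
                  linarith
              _ = 2 * h x := by
                  rw [Real.volume_Ioo, sub_zero, ENNReal.ofReal_mul (by norm_num),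
                    ENNReal.ofReal_toReal hx]
                  norm_num
        calc _ ≤ h x * (2 * h x) := by gcongr
          _ = _ := by ring
    _ = _ := by
        rw [lintegral_const_mul _ (by fun_prop), ← mul_assoc]
        congr 1
        rw [← ENNReal.ofReal_ofNat, ← ENNReal.ofReal_mul (by positivity)]
        congr 1; ring

end Maximal

/-! ### The John–Nirenberg inequality in L² by a stopping-time argument -/

section JohnNirenberg

variable {n : ℕ}

local notation "𝔼" => EuclideanSpace ℝ (Fin n)

/-- Enlarge ρ by factors of 5 and stop just before the mean first falls to a or below. The large
mean on the stopping ball limits the total volume of disjoint such balls; the small mean on its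
fivefold dilate, the ball supplied by the covering lemma, controls the mean of f there. -/
lemma exists_stopping_radius {h : 𝔼 → ℝ≥0∞} {x : 𝔼} {r ρ : ℝ} {a : ℝ≥0∞}
    (hle : ∀ s, r / 5 ≤ s → s ≤ r → ∫⁻ y in ball x s, h y ≤ a * volume (ball x s))
    (hρ : 0 < ρ) (hρr : ρ ≤ r) (hlt : a * volume (ball x ρ) < ∫⁻ y in ball x ρ, h y) :
    ∃ s, 0 < s ∧ 5 * s ≤ r ∧ a * volume (ball x s) < ∫⁻ y in ball x s, h y ∧
      ∫⁻ y in ball x (5 * s), h y ≤ a * volume (ball x (5 * s)) := by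
  -- Here 5^k ρ lies in (r / 5, r], the range in which the mean is known to be at most a, so the
  -- search ends by step k.
  obtain ⟨k, hk1, hk2⟩ := exists_nat_pow_near (x := r / ρ) (y := 5)
    ((one_le_div hρ).2 hρr) (by norm_num)
  rw [le_div_iff₀ hρ] at hk1
  rw [div_lt_iff₀ hρ, pow_succ] at hk2
  classical
  have hex : ∃ j : ℕ, ∫⁻ y in ball x (5 ^ j * ρ), h y ≤ a * volume (ball x (5 ^ j * ρ)) :=
    ⟨k, hle _ (by linarith) hk1⟩
  have hj := Nat.find_spec hex
  have hjk : Nat.find hex ≤ k := Nat.find_min' hex (hle _ (by linarith) hk1)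
  have hj0 : Nat.find hex ≠ 0 := by
    intro h0
    rw [h0, pow_zero, one_mul] at hj
    exact absurd hj (not_le.2 hlt)
  obtain ⟨i, hi⟩ := Nat.exists_eq_succ_of_ne_zero hj0
  have hmin := Nat.find_min hex (m := i) (by omega)
  have e : (5 : ℝ) * (5 ^ i * ρ) = 5 ^ (Nat.find hex) * ρ := by rw [hi, Nat.succ_eq_add_one]; ring
  refine ⟨5 ^ i * ρ, by positivity, ?_, not_le.1 hmin, ?_⟩
  · rw [e]
    refine le_trans ?_ hk1
    gcongr
    norm_num
  · rw [e]; exact hj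

lemma ae_exists_small_ball_average_gt {f : 𝔼 → ℝ} (hf : LocallyIntegrable f) (a : ℝ≥0∞) {R : ℝ}
    (hR : 0 < R) :
    ∀ᵐ x, a < ‖f x‖ₑ → ∃ ρ, 0 < ρ ∧ ρ ≤ R ∧
      a * volume (ball x ρ) < ∫⁻ y in ball x ρ, ‖f y‖ₑ := by
  filter_upwards [IsUnifLocDoublingMeasure.ae_tendsto_average volume hf 1] with x hx hax
  have hlim : Tendsto (fun s : ℝ => ⨍ y in closedBall x s, f y) (𝓝[>] 0) (𝓝 (f x)) := by
    refine hx (fun _ => x) (fun s => s) tendsto_id ?_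
    filter_upwards [self_mem_nhdsWithin] with s hs
    exact mem_closedBall_self (by simpa using! (le_of_lt hs))
  have h1 : ∀ᶠ s : ℝ in 𝓝[>] 0, a < ‖⨍ y in closedBall x s, f y‖ₑ :=
    hlim.enorm.eventually_const_lt hax
  have h2 : ∀ᶠ s : ℝ in 𝓝[>] 0, s ∈ Ioc 0 R := Ioc_mem_nhdsGT hR
  obtain ⟨s, hs1, hs2⟩ := (h1.and h2).exists
  refine ⟨s, hs2.1, hs2.2, ?_⟩
  rw [setAverage_congr (ball_ae_eq_closedBall x hs2.1).symm] at hs1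
  have h3 := enorm_average_sub_mul_le (volume_ball_ne_top x) (volume_ball_ne_zero x hs2.1)
    (integrableOn_ball hf x s) 0
  simp only [sub_zero] at h3
  refine lt_of_lt_of_le ?_ h3
  exact ENNReal.mul_lt_mul_left (volume_ball_ne_zero x hs2.1) (volume_ball_ne_top x) hs1

lemma enorm_sub_sq_le (a b c : ℝ) : ‖a - c‖ₑ ^ 2 ≤ 2 * ‖a - b‖ₑ ^ 2 + 2 * ‖b - c‖ₑ ^ 2 := by
  have h : a - c = (a - b) + (b - c) := by ring
  rw [h, ← mul_add]
  refine (pow_le_pow_left' (enorm_add_le _ _) 2).trans ?_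
  have := ENNReal.rpow_add_le_mul_rpow_add_rpow ‖a - b‖ₑ ‖b - c‖ₑ (p := 2) (by norm_num)
  norm_num at this
  exact this

/-- The mean square oscillation, the `L²` variant of `bmoNorm` (squared). -/
noncomputable def meanSquareOsc (f : 𝔼 → ℝ) : ℝ≥0∞ :=
  ⨆ (c : 𝔼) (r : ℝ) (_ : 0 < r),
    (volume (ball c r))⁻¹ * ∫⁻ x in ball c r, ‖f x - ⨍ y in ball c r, f y‖ₑ ^ 2

lemma lintegral_sq_le_meanSquareOsc (f : 𝔼 → ℝ) (c : 𝔼) {r : ℝ} (hr : 0 < r) :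
    ∫⁻ x in ball c r, ‖f x - ⨍ y in ball c r, f y‖ₑ ^ 2 ≤
      meanSquareOsc f * volume (ball c r) := by
  rw [mul_comm, ← ENNReal.inv_mul_le_iff (volume_ball_ne_zero c hr) (volume_ball_ne_top c)]
  exact le_iSup_of_le c (le_iSup_of_le r (le_iSup_of_le hr le_rfl))

lemma meanSquareOsc_ne_top_of_bounded {f : 𝔼 → ℝ} {N : ℝ}
    (hN : ∀ x, |f x| ≤ N) : meanSquareOsc f ≠ ∞ := by
  have : meanSquareOsc f ≤ ENNReal.ofReal (2 * N) ^ 2 := by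
    refine iSup_le fun c => iSup_le fun r => iSup_le fun hr => ?_
    have hv : 0 < volume.real (ball c r) :=
      ENNReal.toReal_pos (volume_ball_ne_zero c hr) (volume_ball_ne_top c)
    have hav : |⨍ y in ball c r, f y| ≤ N := by
      rw [setAverage_eq, smul_eq_mul, abs_mul, abs_inv, abs_of_pos hv, inv_mul_le_iff₀ hv, mul_comm]
      exact norm_setIntegral_le_of_norm_le_const (f := f) (volume_ball_ne_top c).lt_top fun x _ => hN x
    rw [ENNReal.inv_mul_le_iff (volume_ball_ne_zero c hr) (volume_ball_ne_top c), mul_comm,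
      ← setLIntegral_const]
    refine lintegral_mono fun x => ?_
    gcongr
    rw [Real.enorm_eq_ofReal_abs]
    refine ENNReal.ofReal_le_ofReal ((abs_sub _ _).trans ?_)
    linarith [hN x]
  exact ne_top_of_le_ne_top (ENNReal.pow_ne_top ENNReal.ofReal_ne_top) this

/-- Calderón–Zygmund stopping at height a. Almost everywhere in the ball either |f - m| ≤ a or the
point lies in a dilated stopping ball. On each dilate the square integral is bounded through
`meanSquareOsc f` itself, and the dilates are small enough in total for that term to come back with
coefficient 1/2. -/
lemma lintegral_sq_sub_average_le_aux {f : 𝔼 → ℝ} (hf : LocallyIntegrable f) {K : ℝ≥0∞}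
    (hK0 : K ≠ 0) (hKt : K ≠ ∞) (hK : bmoNorm f ≤ K) (c : 𝔼) {r : ℝ} (hr : 0 < r) :
    ∫⁻ x in ball c r, ‖f x - ⨍ y in ball c r, f y‖ₑ ^ 2 ≤
      ((8 * 20 ^ n * K) ^ 2 + 2⁻¹ * (meanSquareOsc f + (8 * 20 ^ n * K) ^ 2)) *
        volume (ball c r) := by
  set m := ⨍ y in ball c r, f y with hm
  -- The integral of |f - m| over the doubled ball costs 2 · 4^n K, and comparing a ball of radius
  -- at least r / 5 with radius r costs 5^n. The further factor 4 makes the fivefold stopping balls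
  -- fill at most a quarter of the ball.
  set a : ℝ≥0∞ := 8 * 20 ^ n * K with ha
  set A := meanSquareOsc f with hA
  have h2B : ∫⁻ x in ball c (2 * r), ‖f x - m‖ₑ ≤ 2 * 4 ^ n * K * volume (ball c r) := by
    refine (lintegral_ball_mul_sub_average_le hf c hr one_le_two).trans ?_
    rw [volume_ball_mul c c hr two_pos, ENNReal.ofReal_pow (by norm_num), ENNReal.ofReal_ofNat]
    have e4 : (4 : ℝ≥0∞) ^ n = 2 ^ n * 2 ^ n := by rw [← mul_pow]; norm_num
    calc _ ≤ 2 * K * 2 ^ n * (2 ^ n * volume (ball c r)) := by gcongr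
      _ = _ := by rw [e4]; ring
  have hfm : LocallyIntegrable fun x => f x - m := hf.sub (locallyIntegrable_const m)
  have hlarge : ∀ x ∈ ball c r, ∀ s, r / 5 ≤ s → s ≤ r →
      ∫⁻ y in ball x s, ‖f y - m‖ₑ ≤ a * volume (ball x s) := by
    intro x hx s hs1 hs2
    have hsub : ball x s ⊆ ball c (2 * r) :=
      ball_subset_ball' (by rw [mem_ball] at hx; linarith)
    have hvol : volume (ball c r) ≤ 5 ^ n * volume (ball x s) := by
      have h5 : r = 5 * (r / 5) := by ring
      rw [h5, volume_ball_mul c x (by positivity) (by norm_num), ENNReal.ofReal_pow (by norm_num),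
        ENNReal.ofReal_ofNat]
      gcongr
    have e20 : (20 : ℝ≥0∞) ^ n = 4 ^ n * 5 ^ n := by rw [← mul_pow]; norm_num
    calc _ ≤ 2 * 4 ^ n * K * volume (ball c r) := (lintegral_mono_set hsub).trans h2B
      _ ≤ 2 * 4 ^ n * K * (5 ^ n * volume (ball x s)) := by gcongr
      _ = 2 * 20 ^ n * K * volume (ball x s) := by rw [e20]; ring
      _ ≤ a * volume (ball x s) := by rw [ha]; gcongr; norm_num
  set t : Set (𝔼 × ℝ) := {p | p.1 ∈ ball c r ∧ 0 < p.2 ∧ 5 * p.2 ≤ r ∧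
    a * volume (ball p.1 p.2) < ∫⁻ y in ball p.1 p.2, ‖f y - m‖ₑ ∧
    ∫⁻ y in ball p.1 (5 * p.2), ‖f y - m‖ₑ ≤ a * volume (ball p.1 (5 * p.2))} with ht
  obtain ⟨u, hut, hc, hdis, hcov⟩ := exists_countable_disjoint_balls_cover t r
    fun p hp => ⟨hp.2.1, by linarith [hp.2.1, hp.2.2.1]⟩
  have := hc.to_subtype
  have hae : ∀ᵐ x, x ∈ ball c r → ‖f x - m‖ₑ ^ 2 ≤
      a ^ 2 + (⋃ p : u, ball p.1.1 (5 * p.1.2)).indicator (fun x => ‖f x - m‖ₑ ^ 2) x := by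
    filter_upwards [ae_exists_small_ball_average_gt hfm a hr] with x hx hxB
    rcases le_or_gt ‖f x - m‖ₑ a with hle | hgt
    · exact le_add_right (pow_le_pow_left' hle 2)
    · obtain ⟨ρ, hρ, hρr, hlt⟩ := hx hgt
      obtain ⟨s, hs0, hs5, hs1, hs2⟩ := exists_stopping_radius (hlarge x hxB) hρ hρr hlt
      obtain ⟨q, hq, hsub⟩ := hcov (x, s) ⟨hxB, hs0, hs5, hs1, hs2⟩
      rw [indicator_of_mem]
      · exact le_add_self
      · exact mem_iUnion.2 ⟨⟨q, hq⟩, hsub (mem_ball_self hs0)⟩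
  have hball : ∀ p ∈ t, ∫⁻ x in ball p.1 (5 * p.2), ‖f x - m‖ₑ ^ 2 ≤
      2 * (A + a ^ 2) * (5 ^ n * volume (ball p.1 p.2)) := by
    intro p hp
    have hp5 : 0 < 5 * p.2 := by linarith [hp.2.1]
    set b := ⨍ y in ball p.1 (5 * p.2), f y with hb
    -- The stopping condition on the dilate bounds the jump of the mean.
    have hbm : ‖b - m‖ₑ ≤ a := by
      have h1 := (enorm_average_sub_mul_le (volume_ball_ne_top p.1) (volume_ball_ne_zero p.1 hp5)
        (integrableOn_ball hf _ _) m).trans hp.2.2.2.2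
      exact (ENNReal.mul_le_mul_iff_left (volume_ball_ne_zero p.1 hp5)
        (volume_ball_ne_top p.1)).1 h1
    calc ∫⁻ x in ball p.1 (5 * p.2), ‖f x - m‖ₑ ^ 2
        ≤ ∫⁻ x in ball p.1 (5 * p.2), (2 * ‖f x - b‖ₑ ^ 2 + 2 * a ^ 2) := by
          refine lintegral_mono fun x => (enorm_sub_sq_le _ b _).trans ?_
          gcongr
      _ = 2 * (∫⁻ x in ball p.1 (5 * p.2), ‖f x - b‖ₑ ^ 2) +
          2 * a ^ 2 * volume (ball p.1 (5 * p.2)) := by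
          rw [lintegral_add_right _ measurable_const, setLIntegral_const,
            lintegral_const_mul' _ _ (by norm_num)]
      _ ≤ 2 * (A * volume (ball p.1 (5 * p.2))) + 2 * a ^ 2 * volume (ball p.1 (5 * p.2)) := by
          gcongr
          exact lintegral_sq_le_meanSquareOsc f p.1 hp5
      _ = _ := by
          rw [volume_ball_mul p.1 p.1 hp.2.1 (by norm_num : (0 : ℝ) < 5),
            ENNReal.ofReal_pow (by norm_num), ENNReal.ofReal_ofNat]
          ring
  have hsum : 4 * (5 ^ n * ∑' p : u, volume (ball p.1.1 p.1.2)) ≤ volume (ball c r) := by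
    have h1 : a * ∑' p : u, volume (ball p.1.1 p.1.2) ≤ ∫⁻ x in ball c (2 * r), ‖f x - m‖ₑ := by
      refine mul_tsum_volume_ball_le hc hdis (fun p hp => ?_) fun p hp => (hut hp).2.2.2.1.le
      have h3 := (hut hp).1
      rw [mem_ball] at h3
      exact ball_subset_ball' (by linarith [(hut hp).2.1, (hut hp).2.2.1])
    have e20 : (20 : ℝ≥0∞) ^ n = 4 ^ n * 5 ^ n := by rw [← mul_pow]; norm_num
    have h2 := h1.trans h2B
    have h4 : (2 * 4 ^ n * K) * (4 * (5 ^ n * ∑' p : u, volume (ball p.1.1 p.1.2))) ≤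
        (2 * 4 ^ n * K) * volume (ball c r) := by
      refine le_trans (le_of_eq ?_) h2
      rw [ha, e20]; ring
    refine (ENNReal.mul_le_mul_iff_right ?_ ?_).1 h4
    · simp [hK0]
    · exact ENNReal.mul_ne_top (by finiteness) hKt
  calc ∫⁻ x in ball c r, ‖f x - m‖ₑ ^ 2
      ≤ ∫⁻ x in ball c r, (a ^ 2 +
        (⋃ p : u, ball p.1.1 (5 * p.1.2)).indicator (fun x => ‖f x - m‖ₑ ^ 2) x) :=
        setLIntegral_mono_ae' measurableSet_ball hae
    _ ≤ a ^ 2 * volume (ball c r) +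
        ∫⁻ x in ⋃ p : u, ball p.1.1 (5 * p.1.2), ‖f x - m‖ₑ ^ 2 := by
        rw [lintegral_add_left measurable_const, setLIntegral_const]
        refine add_le_add le_rfl ?_
        rw [← lintegral_indicator (MeasurableSet.iUnion fun _ => measurableSet_ball)]
        exact setLIntegral_le_lintegral _ _
    _ ≤ a ^ 2 * volume (ball c r) +
        ∑' p : u, 2 * (A + a ^ 2) * (5 ^ n * volume (ball p.1.1 p.1.2)) := by
        gcongr
        exact (lintegral_iUnion_le _ _).trans (ENNReal.tsum_le_tsum fun p => hball p.1 (hut p.2))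
    _ = a ^ 2 * volume (ball c r) +
        2⁻¹ * (A + a ^ 2) * (4 * (5 ^ n * ∑' p : u, volume (ball p.1.1 p.1.2))) := by
        rw [ENNReal.tsum_mul_left, ENNReal.tsum_mul_left]
        congr 1
        have : (2 : ℝ≥0∞) = 2⁻¹ * 4 := by
          rw [show (4 : ℝ≥0∞) = 2 * 2 by norm_num, ← mul_assoc,
            ENNReal.inv_mul_cancel (by norm_num) (by norm_num), one_mul]
        calc _ = (2⁻¹ * 4) * (A + a ^ 2) * (5 ^ n * ∑' p : u, volume (ball p.1.1 p.1.2)) := by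
              rw [← this]
          _ = _ := by ring
    _ ≤ a ^ 2 * volume (ball c r) + 2⁻¹ * (A + a ^ 2) * volume (ball c r) := by gcongr
    _ = _ := by ring

/-- With A the mean square oscillation, A ≤ a² + (A + a²) / 2. Boundedness of f makes A finite, so A
/ 2 can be absorbed, leaving A ≤ 3a² whatever the bound N. -/
lemma meanSquareOsc_le_of_bounded {f : 𝔼 → ℝ} (hf : LocallyIntegrable f) {N : ℝ}
    (hN : ∀ x, |f x| ≤ N) {K : ℝ≥0∞} (hK0 : K ≠ 0) (hKt : K ≠ ∞) (hK : bmoNorm f ≤ K) :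
    meanSquareOsc f ≤ 3 * (8 * 20 ^ n * K) ^ 2 := by
  have hA := meanSquareOsc_ne_top_of_bounded hN
  set a : ℝ≥0∞ := 8 * 20 ^ n * K with ha
  have hat : a ≠ ∞ := by rw [ha]; finiteness
  have h1 : meanSquareOsc f ≤ a ^ 2 + 2⁻¹ * (meanSquareOsc f + a ^ 2) := by
    conv_lhs => rw [meanSquareOsc]
    refine iSup_le fun c => iSup_le fun r => iSup_le fun hr => ?_
    rw [ENNReal.inv_mul_le_iff (volume_ball_ne_zero c hr) (volume_ball_ne_top c), mul_comm]
    exact lintegral_sq_sub_average_le_aux hf hK0 hKt hK c hr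
  lift meanSquareOsc f to ℝ≥0 using hA with A
  lift a to ℝ≥0 using hat with a'
  have h2 : (2⁻¹ : ℝ≥0∞) = ((2⁻¹ : ℝ≥0) : ℝ≥0∞) := by
    rw [ENNReal.coe_inv (by norm_num)]; rfl
  rw [h2] at h1
  norm_cast at h1 ⊢
  rw [← NNReal.coe_le_coe] at h1 ⊢
  push_cast at h1 ⊢
  linarith

lemma lintegral_truncation_sub_le (f : 𝔼 → ℝ) (N b : ℝ) (s : Set 𝔼) :
    ∫⁻ x in s, ‖max (-N) (min (f x) N) - max (-N) (min b N)‖ₑ ≤ ∫⁻ x in s, ‖f x - b‖ₑ := by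
  refine lintegral_mono fun x => ?_
  rw [Real.enorm_eq_ofReal_abs, Real.enorm_eq_ofReal_abs]
  refine ENNReal.ofReal_le_ofReal ?_
  refine (abs_max_sub_max_le_max _ _ _ _).trans ?_
  rw [sub_self, abs_zero]
  refine max_le (abs_nonneg _) ((abs_min_sub_min_le_max _ _ _ _).trans ?_)
  rw [sub_self, abs_zero]
  exact max_le le_rfl (abs_nonneg _)

/-- The `L²` form of the John–Nirenberg inequality. -/
theorem lintegral_sq_sub_average_le {f : 𝔼 → ℝ} (hf : LocallyIntegrable f) (hfin : bmoNorm f ≠ ∞)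
    (c : 𝔼) {r : ℝ} (hr : 0 < r) :
    ∫⁻ x in ball c r, ‖f x - ⨍ y in ball c r, f y‖ₑ ^ 2 ≤
      3 * (16 * 20 ^ n * bmoNorm f) ^ 2 * volume (ball c r) := by
  rcases eq_or_ne (bmoNorm f) 0 with h0 | h0
  -- The bound for bounded functions divides by K, so seminorm zero is treated apart: there f equals
  -- its mean almost everywhere on the ball.
  · have h1 := lintegral_oscillation_le_bmoNorm f c hr
    have hm : AEMeasurable (fun x => ‖f x - ⨍ y in ball c r, f y‖ₑ) (volume.restrict (ball c r)) :=
      ((hf.aestronglyMeasurable.sub aestronglyMeasurable_const).enorm).restrict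
    rw [h0, zero_mul, nonpos_iff_eq_zero, lintegral_eq_zero_iff' hm] at h1
    refine le_trans (le_of_eq ?_) zero_le
    rw [lintegral_eq_zero_iff' (hm.pow_const 2)]
    filter_upwards [h1] with x hx
    simp only [Pi.zero_apply] at hx ⊢
    rw [hx]; norm_num
  -- Truncation is 1-Lipschitz, so it at most doubles the seminorm (8 becomes 16); Fatou's lemma
  -- then removes the truncation.
  set g : ℕ → 𝔼 → ℝ := fun N x => max (-(N : ℝ)) (min (f x) N) with hg
  have hgb : ∀ N x, |g N x| ≤ N := fun N x => abs_le.2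
    ⟨le_max_left _ _, max_le (by linarith [Nat.cast_nonneg (α := ℝ) N]) (min_le_right _ _)⟩
  have hgm : ∀ N, AEStronglyMeasurable (g N) := fun N =>
    (((continuous_const.max (continuous_id.min continuous_const) :
      Continuous fun y : ℝ => max (-(N : ℝ)) (min y N))).comp_aestronglyMeasurable
      hf.aestronglyMeasurable)
  have hgf : ∀ N x, ‖g N x‖ ≤ ‖f x‖ := by
    intro N x
    have hN := Nat.cast_nonneg (α := ℝ) N
    rw [Real.norm_eq_abs, Real.norm_eq_abs]
    refine abs_le.2 ⟨?_, ?_⟩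
    · rcases le_total (f x) N with h | h
      · exact le_max_of_le_right (by rw [min_eq_left h]; exact neg_abs_le _)
      · refine le_max_of_le_right ?_
        rw [min_eq_right h]; linarith [abs_nonneg (f x)]
    · refine max_le (by linarith [abs_nonneg (f x)]) ((min_le_left _ _).trans (le_abs_self _))
  have hgl : ∀ N, LocallyIntegrable (g N) := fun N =>
    hf.mono (hgm N) (Eventually.of_forall (hgf N))
  have hgK : ∀ N, bmoNorm (g N) ≤ 2 * bmoNorm f := fun N =>
    bmoNorm_le_of_forall_ball (hgl N) fun c r hr => ⟨_,
      (lintegral_truncation_sub_le f N (⨍ y in ball c r, f y) _).trans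
        (lintegral_oscillation_le_bmoNorm f c hr)⟩
  have hlim : ∀ x, Tendsto (fun N => g N x) atTop (𝓝 (f x)) := by
    intro x
    obtain ⟨M, hM⟩ := exists_nat_ge |f x|
    refine tendsto_const_nhds.congr' ?_
    filter_upwards [eventually_ge_atTop M] with N hN
    have : |f x| ≤ N := hM.trans (by exact_mod_cast hN)
    rw [abs_le] at this
    simp only [hg]
    rw [min_eq_left this.2, max_eq_right this.1]
  have hav : Tendsto (fun N => ⨍ y in ball c r, g N y) atTop (𝓝 (⨍ y in ball c r, f y)) := by
    simp only [setAverage_eq]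
    refine Tendsto.const_smul ?_ _
    exact tendsto_integral_of_dominated_convergence (fun x => ‖f x‖) (fun N => (hgm N).restrict)
      (integrableOn_ball hf c r).norm (fun N => Eventually.of_forall (hgf N))
      (Eventually.of_forall hlim)
  calc ∫⁻ x in ball c r, ‖f x - ⨍ y in ball c r, f y‖ₑ ^ 2
      = ∫⁻ x in ball c r, liminf (fun N => ‖g N x - ⨍ y in ball c r, g N y‖ₑ ^ 2) atTop := by
        refine lintegral_congr fun x => ?_
        exact (((ENNReal.continuous_pow 2).tendsto _).comp ((hlim x).sub hav).enorm).liminf_eq.symm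
    _ ≤ liminf (fun N => ∫⁻ x in ball c r, ‖g N x - ⨍ y in ball c r, g N y‖ₑ ^ 2) atTop :=
        lintegral_liminf_le' fun N =>
          (((hgm N).sub aestronglyMeasurable_const).enorm.restrict).pow_const 2
    _ ≤ _ := by
        refine liminf_le_of_le (by isBoundedDefault) fun b hb => ?_
        obtain ⟨N, hN⟩ := hb.exists
        refine hN.trans ((lintegral_sq_le_meanSquareOsc (g N) c hr).trans ?_)
        gcongr
        refine (meanSquareOsc_le_of_bounded (hgl N) (hgb N) (K := 2 * bmoNorm f)
          (by simp [h0]) (by finiteness) (hgK N)).trans (le_of_eq ?_)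
        ring

end JohnNirenberg

/-! ### Dilated Schwartz kernels and their convolution operators -/

section Kernels

variable {n : ℕ}

local notation "𝔼" => EuclideanSpace ℝ (Fin n)

lemma SchwartzMap.exists_norm_le_inv_pow {F : Type*} [NormedAddCommGroup F] [NormedSpace ℝ F]
    (f : 𝓢(𝔼, F)) (k : ℕ) : ∃ C : ℝ, 0 < C ∧ ∀ x, ‖f x‖ ≤ C * ((1 + ‖x‖) ^ k)⁻¹ := by
  set C := 2 ^ k * ((Finset.Iic (k, 0)).sup fun m => SchwartzMap.seminorm ℝ m.1 m.2) f with hC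
  have hC0 : 0 ≤ C := mul_nonneg (by positivity) (apply_nonneg _ _)
  refine ⟨C + 1, by linarith, fun x => ?_⟩
  have h := SchwartzMap.one_add_le_sup_seminorm_apply (𝕜 := ℝ) (m := (k, 0)) le_rfl le_rfl f x
  rw [norm_iteratedFDeriv_zero] at h
  have hx : 0 < (1 + ‖x‖) ^ k := by positivity
  rw [← div_eq_mul_inv, le_div_iff₀ hx, mul_comm]
  linarith

lemma SchwartzMap.exists_norm_fderiv_le_inv_pow {F : Type*} [NormedAddCommGroup F]
    [NormedSpace ℝ F] (f : 𝓢(𝔼, F)) (k : ℕ) :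
    ∃ C : ℝ, 0 < C ∧ ∀ x, ‖fderiv ℝ f x‖ ≤ C * ((1 + ‖x‖) ^ k)⁻¹ :=
  SchwartzMap.exists_norm_le_inv_pow (SchwartzMap.fderivCLM ℝ 𝔼 F f) k

/-- The function `-(n φ + x · ∇φ)`, which satisfies `s ∂_s φ_s = ψ_s`. -/
noncomputable def scaleDeriv (φ : 𝓢(𝔼, ℝ)) : 𝓢(𝔼, ℝ) :=
  -((n : ℝ) • φ + SchwartzMap.bilinLeftCLM (ContinuousLinearMap.id ℝ (𝔼 →L[ℝ] ℝ))
    (Function.HasTemperateGrowth.id (E := 𝔼)) (SchwartzMap.fderivCLM ℝ 𝔼 ℝ φ))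

lemma scaleDeriv_apply (φ : 𝓢(𝔼, ℝ)) (x : 𝔼) :
    scaleDeriv φ x = -(n * φ x + fderiv ℝ φ x x) := rfl

lemma hasDerivAt_dilate (φ : 𝓢(𝔼, ℝ)) (z : 𝔼) {s : ℝ} (hs : 0 < s) :
    HasDerivAt (fun s => dilate φ s z) (s⁻¹ * dilate (scaleDeriv φ) s z) s := by
  have h1 : HasDerivAt (fun s : ℝ => (s ^ n)⁻¹) (-(n * s ^ (n - 1)) / (s ^ n) ^ 2) s :=
    (hasDerivAt_pow n s).inv (by positivity)
  have h2 : HasDerivAt (fun s : ℝ => s⁻¹ • z) ((-(s ^ 2)⁻¹) • z) s :=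
    (hasDerivAt_inv hs.ne').smul_const z
  have h3 := (φ.hasFDerivAt (s⁻¹ • z)).comp_hasDerivAt s h2
  have h4 := h1.mul h3
  refine h4.congr_deriv ?_
  simp only [dilate, scaleDeriv_apply, map_smul, smul_eq_mul, Function.comp]
  have e : (n : ℝ) * s ^ (n - 1) * s = n * s ^ n := by
    rcases Nat.eq_zero_or_pos n with h0 | h0
    · simp [h0]
    · rw [mul_assoc, ← pow_succ, Nat.sub_add_cancel h0]
  have e' : -(n * s ^ (n - 1)) / (s ^ n) ^ 2 = -(s⁻¹ * (s ^ n)⁻¹ * n) := by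
    have : (n : ℝ) * s ^ (n - 1) = n * s ^ n / s := by rw [← e]; field_simp
    rw [this]; field_simp
  rw [e']
  field_simp
  ring

/-- Schwartz decay of order n + j, rescaled. The case j = 1 gives an integrable majorant, j = 0 a
uniform bound. -/
lemma exists_dilate_le (φ : 𝓢(𝔼, ℝ)) (j : ℕ) : ∃ C : ℝ, 0 < C ∧ ∀ s : ℝ, 0 < s → ∀ z : 𝔼,
    |dilate φ s z| ≤ C * (s ^ j * ((s + ‖z‖) ^ (n + j))⁻¹) := by
  obtain ⟨C, hC, h⟩ := φ.exists_norm_le_inv_pow (n + j)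
  refine ⟨C, hC, fun s hs z => ?_⟩
  have h1 := h (s⁻¹ • z)
  rw [norm_smul, norm_inv, Real.norm_eq_abs, Real.norm_eq_abs, abs_of_pos hs] at h1
  have e : 1 + s⁻¹ * ‖z‖ = (s + ‖z‖) / s := by field_simp
  rw [dilate, abs_mul, abs_inv, abs_of_pos (by positivity : 0 < s ^ n)]
  have hz : 0 < s + ‖z‖ := by positivity
  calc _ ≤ (s ^ n)⁻¹ * (C * ((1 + s⁻¹ * ‖z‖) ^ (n + j))⁻¹) := by gcongr
    _ = _ := by
      rw [e, div_pow, inv_div, pow_add s]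
      field_simp

/-- Mean value inequality along the segment. The exponent n + 3 is chosen so that, after division by
s, a power s remains to be spent on reaching exponent n + 2. -/
lemma exists_dilate_sub_le (φ : 𝓢(𝔼, ℝ)) : ∃ C : ℝ, 0 < C ∧ ∀ s : ℝ, 0 < s → ∀ (R : ℝ) (u v : 𝔼),
    0 ≤ R → (∀ w ∈ segment ℝ v u, R ≤ ‖w‖) →
    |dilate φ s u - dilate φ s v| ≤ C * ‖u - v‖ * (s ^ 2 * ((s + R) ^ (n + 3))⁻¹) := by
  obtain ⟨C, hC, h⟩ := φ.exists_norm_fderiv_le_inv_pow (n + 3)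
  refine ⟨C, hC, fun s hs R u v hR0 hR => ?_⟩
  have hd : ∀ w ∈ segment ℝ v u, HasFDerivWithinAt (dilate φ s)
      ((s ^ n)⁻¹ • (fderiv ℝ φ (s⁻¹ • w)).comp (s⁻¹ • ContinuousLinearMap.id ℝ 𝔼))
      (segment ℝ v u) w := by
    intro w _
    have h2 : HasFDerivAt (fun w : 𝔼 => s⁻¹ • w) (s⁻¹ • ContinuousLinearMap.id ℝ 𝔼) w :=
      (hasFDerivAt_id w).const_smul s⁻¹
    exact (((φ.hasFDerivAt (s⁻¹ • w)).comp w h2).const_mul _).hasFDerivWithinAt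
  have hb : ∀ w ∈ segment ℝ v u,
      ‖(s ^ n)⁻¹ • (fderiv ℝ φ (s⁻¹ • w)).comp (s⁻¹ • ContinuousLinearMap.id ℝ 𝔼)‖ ≤
        C * (s ^ 2 * ((s + R) ^ (n + 3))⁻¹) := by
    intro w hw
    have hid : ‖s⁻¹ • ContinuousLinearMap.id ℝ 𝔼‖ ≤ s⁻¹ := by
      rw [norm_smul, norm_inv, Real.norm_eq_abs, abs_of_pos hs]
      exact mul_le_of_le_one_right (by positivity) ContinuousLinearMap.norm_id_le
    have h1 := h (s⁻¹ • w)
    rw [norm_smul s⁻¹ w, norm_inv, Real.norm_eq_abs, abs_of_pos hs] at h1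
    have e : (s + R) / s ≤ 1 + s⁻¹ * ‖w‖ := by
      have := hR w hw
      rw [div_le_iff₀ hs]
      have : (1 + s⁻¹ * ‖w‖) * s = s + ‖w‖ := by field_simp
      linarith
    have hz : 0 < s + R := by positivity
    rw [norm_smul, norm_inv, norm_pow, Real.norm_eq_abs, abs_of_pos hs]
    calc _ ≤ (s ^ n)⁻¹ * ((C * ((1 + s⁻¹ * ‖w‖) ^ (n + 3))⁻¹) * s⁻¹) := by
          gcongr
          exact (ContinuousLinearMap.opNorm_comp_le _ _).trans (by gcongr)
      _ ≤ (s ^ n)⁻¹ * ((C * (((s + R) / s) ^ (n + 3))⁻¹) * s⁻¹) := by gcongr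
      _ = _ := by
        rw [div_pow, inv_div, pow_add s]
        field_simp
  have := (convex_segment v u).norm_image_sub_le_of_norm_hasFDerivWithin_le hd hb
    (left_mem_segment ℝ v u) (right_mem_segment ℝ v u)
  rw [Real.norm_eq_abs] at this
  linarith

lemma measurable_dilate (φ : 𝓢(𝔼, ℝ)) : Measurable fun p : ℝ × 𝔼 => dilate φ p.1 p.2 := by
  have := φ.continuous.measurable
  unfold dilate
  fun_prop

lemma continuous_dilate (φ : 𝓢(𝔼, ℝ)) (s : ℝ) : Continuous (dilate φ s) := by
  have := φ.continuous
  unfold dilate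
  fun_prop

/-- `w` is integrable against the weight `(1 + ‖y‖)^{-(n+1)}`. -/
def TailIntegrable (w : 𝔼 → ℝ) : Prop := Integrable fun y => ((1 + ‖y‖) ^ (n + 1))⁻¹ * w y

lemma tailWeight_le {s₀ s M : ℝ} (hs₀ : 0 < s₀) (hs : s₀ ≤ s) {x : 𝔼} (hx : ‖x‖ ≤ M) (y : 𝔼) :
    ((s + ‖x - y‖) ^ (n + 1))⁻¹ ≤
      ((1 + M) / min s₀ 1) ^ (n + 1) * ((1 + ‖y‖) ^ (n + 1))⁻¹ := by
  have hM : 0 ≤ M := (norm_nonneg x).trans hx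
  have hm : 0 < min s₀ 1 := lt_min hs₀ one_pos
  have h1 : 0 < s + ‖x - y‖ := by linarith [norm_nonneg (x - y)]
  have hy : ‖y‖ ≤ ‖x‖ + ‖x - y‖ := by
    have := norm_sub_le x (x - y); simpa using this
  have key : (1 + ‖y‖) * min s₀ 1 ≤ (1 + M) * (s + ‖x - y‖) := by
    have h3 : min s₀ 1 * (1 + ‖x - y‖) ≤ s + ‖x - y‖ := by
      have a1 := min_le_left s₀ 1
      have a2 := min_le_right s₀ 1
      nlinarith [norm_nonneg (x - y)]
    have h4 : 1 + ‖y‖ ≤ (1 + M) * (1 + ‖x - y‖) := by nlinarith [norm_nonneg (x - y)]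
    calc (1 + ‖y‖) * min s₀ 1 ≤ (1 + M) * (1 + ‖x - y‖) * min s₀ 1 := by gcongr
      _ = (1 + M) * (min s₀ 1 * (1 + ‖x - y‖)) := by ring
      _ ≤ _ := by gcongr
  rw [← inv_pow, ← inv_pow, ← mul_pow]
  gcongr
  rw [inv_le_iff_one_le_mul₀ h1, div_mul_eq_mul_div, div_mul_eq_mul_div, le_div_iff₀ hm]
  have h2 : 0 < 1 + ‖y‖ := by positivity
  calc 1 * min s₀ 1 = (1 + ‖y‖) * min s₀ 1 * (1 + ‖y‖)⁻¹ := by field_simp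
    _ ≤ (1 + M) * (s + ‖x - y‖) * (1 + ‖y‖)⁻¹ := by gcongr
    _ = _ := by ring

lemma TailIntegrable.aestronglyMeasurable {w : 𝔼 → ℝ} (hw : TailIntegrable w) :
    AEStronglyMeasurable w := by
  have h := hw.1
  have h2 : AEStronglyMeasurable fun y : 𝔼 => (1 + ‖y‖) ^ (n + 1) :=
    (by fun_prop : Continuous fun y : 𝔼 => (1 + ‖y‖) ^ (n + 1)).aestronglyMeasurable
  refine (h2.mul h).congr (Eventually.of_forall fun y => ?_)
  have : 0 < (1 + ‖y‖) ^ (n + 1) := by positivity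
  simp only [Pi.mul_apply]
  field_simp

lemma TailIntegrable.of_integrable {w : 𝔼 → ℝ} (hw : Integrable w) : TailIntegrable w := by
  refine hw.mono ((by fun_prop (disch := intros; positivity) :
    Continuous fun y : 𝔼 => ((1 + ‖y‖) ^ (n + 1))⁻¹).aestronglyMeasurable.mul hw.1)
    (Eventually.of_forall fun y => ?_)
  rw [norm_mul, norm_inv, norm_pow, Real.norm_eq_abs, abs_of_nonneg (by positivity)]
  refine mul_le_of_le_one_left (norm_nonneg _) (inv_le_one_of_one_le₀ (one_le_pow₀ ?_))
  linarith [norm_nonneg y]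

lemma tailIntegrable_const (m : ℝ) : TailIntegrable (fun _ : 𝔼 => m) := by
  have h : Integrable fun y : 𝔼 => (1 + ‖y‖) ^ (-((n : ℝ) + 1)) :=
    integrable_one_add_norm (by simp)
  refine (h.mul_const m).congr (Eventually.of_forall fun y => ?_)
  have : (0 : ℝ) < 1 + ‖y‖ := by positivity
  simp only
  rw [Real.rpow_neg this.le, ← Nat.cast_succ, Real.rpow_natCast]

lemma TailIntegrable.add {v w : 𝔼 → ℝ} (hv : TailIntegrable v) (hw : TailIntegrable w) :
    TailIntegrable (fun y => v y + w y) := by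
  refine (Integrable.add hv hw).congr (Eventually.of_forall fun y => ?_)
  simp only [Pi.add_apply]; ring

lemma TailIntegrable.sub {v w : 𝔼 → ℝ} (hv : TailIntegrable v) (hw : TailIntegrable w) :
    TailIntegrable (fun y => v y - w y) := by
  refine (Integrable.sub hv hw).congr (Eventually.of_forall fun y => ?_)
  simp only [Pi.sub_apply]; ring

lemma TailIntegrable.integrable_weight {w : 𝔼 → ℝ} (hw : TailIntegrable w) {s : ℝ} (hs : 0 < s)
    (x : 𝔼) : Integrable fun y => ((s + ‖x - y‖) ^ (n + 1))⁻¹ * ‖w y‖ := by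
  refine (hw.norm.const_mul (((1 + ‖x‖) / min s 1) ^ (n + 1))).mono
    ((by fun_prop (disch := intros; positivity) :
      Continuous fun y : 𝔼 => ((s + ‖x - y‖) ^ (n + 1))⁻¹).aestronglyMeasurable.mul
        hw.aestronglyMeasurable.norm) (Eventually.of_forall fun y => ?_)
  have h := tailWeight_le hs le_rfl (le_refl ‖x‖) y
  have hm : 0 < min s 1 := lt_min hs one_pos
  simp only [norm_mul, norm_norm]
  rw [← mul_assoc]
  refine mul_le_mul_of_nonneg_right ?_ (norm_nonneg _)
  rwa [Real.norm_of_nonneg (by positivity), Real.norm_of_nonneg (by positivity),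
    Real.norm_of_nonneg (by positivity)]

lemma convOp_apply (φ : 𝔼 → ℝ) (s : ℝ) (w : 𝔼 → ℝ) (x : 𝔼) :
    convOp φ s w x = ∫ y, dilate φ s (x - y) * w y := by
  rw [convOp, convolution_lsmul_swap]; rfl

lemma TailIntegrable.integrable_dilate_mul {w : 𝔼 → ℝ} (hw : TailIntegrable w) (φ : 𝓢(𝔼, ℝ))
    {s : ℝ} (hs : 0 < s) (x : 𝔼) : Integrable fun y => dilate φ s (x - y) * w y := by
  obtain ⟨C, hC, h⟩ := exists_dilate_le φ 1
  refine ((hw.integrable_weight hs x).const_mul (C * s)).mono'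
    (((continuous_dilate φ s).comp (by fun_prop)).aestronglyMeasurable.mul
      hw.aestronglyMeasurable) (Eventually.of_forall fun y => ?_)
  rw [norm_mul, ← mul_assoc]
  gcongr
  have := h s hs (x - y)
  rw [pow_one, ← mul_assoc] at this
  exact this

lemma TailIntegrable.convolutionExists {w : 𝔼 → ℝ} (hw : TailIntegrable w) (φ : 𝓢(𝔼, ℝ))
    {s : ℝ} (hs : 0 < s) :
    ConvolutionExists (dilate φ s) w (ContinuousLinearMap.lsmul ℝ ℝ) volume := by
  intro x
  have h := (hw.integrable_dilate_mul φ hs x).comp_sub_left x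
  refine h.congr (Eventually.of_forall fun y => ?_)
  simp

lemma convOp_add (φ : 𝓢(𝔼, ℝ)) {s : ℝ} (hs : 0 < s) {v w : 𝔼 → ℝ} (hv : TailIntegrable v)
    (hw : TailIntegrable w) (x : 𝔼) :
    convOp φ s (fun y => v y + w y) x = convOp φ s v x + convOp φ s w x := by
  simp only [convOp_apply, mul_add]
  exact integral_add (hv.integrable_dilate_mul φ hs x) (hw.integrable_dilate_mul φ hs x)

lemma convOp_sub (φ : 𝓢(𝔼, ℝ)) {s : ℝ} (hs : 0 < s) {v w : 𝔼 → ℝ} (hv : TailIntegrable v)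
    (hw : TailIntegrable w) (x : 𝔼) :
    convOp φ s (fun y => v y - w y) x = convOp φ s v x - convOp φ s w x := by
  simp only [convOp_apply, mul_sub]
  exact integral_sub (hv.integrable_dilate_mul φ hs x) (hw.integrable_dilate_mul φ hs x)

lemma integral_dilate (φ : 𝔼 → ℝ) {s : ℝ} (hs : 0 < s) : ∫ z, dilate φ s z = ∫ z, φ z := by
  simp only [dilate]
  rw [integral_const_mul, Measure.integral_comp_smul, finrank_euclideanSpace_fin, smul_eq_mul,
    inv_pow, inv_inv, abs_of_pos (by positivity), ← mul_assoc, inv_mul_cancel₀ (by positivity),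
    one_mul]

lemma convOp_const (φ : 𝔼 → ℝ) {s : ℝ} (hs : 0 < s) (m : ℝ) (x : 𝔼) :
    convOp φ s (fun _ => m) x = (∫ z, φ z) * m := by
  rw [convOp_apply, integral_mul_const, integral_sub_left_eq_self (dilate φ s),
    integral_dilate φ hs]

lemma continuous_convOp (φ : 𝓢(𝔼, ℝ)) {s : ℝ} (hs : 0 < s) {w : 𝔼 → ℝ} (hw : TailIntegrable w) :
    Continuous (convOp φ s w) := by
  obtain ⟨C, hC, h⟩ := exists_dilate_le φ 1
  have e : convOp φ s w = fun x => ∫ y, dilate φ s (x - y) * w y := funext (convOp_apply φ s w)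
  rw [e, continuous_iff_continuousAt]
  intro x₀
  refine continuousAt_of_dominated (bound := fun y =>
    C * s * ((1 + (‖x₀‖ + 1)) / min s 1) ^ (n + 1) * ‖((1 + ‖y‖) ^ (n + 1))⁻¹ * w y‖) ?_ ?_ ?_ ?_
  · exact Eventually.of_forall fun x => (hw.integrable_dilate_mul φ hs x).1
  · filter_upwards [ball_mem_nhds x₀ one_pos] with x hx
    refine Eventually.of_forall fun y => ?_
    have hx' : ‖x‖ ≤ ‖x₀‖ + 1 := by
      rw [mem_ball, dist_eq_norm] at hx
      have := norm_add_le x₀ (x - x₀)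
      rw [add_sub_cancel] at this; linarith
    have h1 := tailWeight_le hs le_rfl hx' y
    have h2 := h s hs (x - y)
    rw [pow_one, ← mul_assoc] at h2
    rw [norm_mul, norm_mul, norm_inv, norm_pow, Real.norm_eq_abs (1 + ‖y‖),
      abs_of_pos (by positivity : 0 < 1 + ‖y‖), ← mul_assoc]
    gcongr
    refine h2.trans ?_
    rw [mul_assoc (C * s)]
    gcongr
  · exact hw.norm.const_mul _
  · refine Eventually.of_forall fun y => ?_
    have := continuous_dilate φ s
    fun_prop

lemma hasDerivAt_convOp (φ : 𝓢(𝔼, ℝ)) {s : ℝ} (hs : 0 < s) {w : 𝔼 → ℝ} (hw : TailIntegrable w)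
    (x : 𝔼) : HasDerivAt (fun s => convOp φ s w x) (s⁻¹ * convOp (scaleDeriv φ) s w x) s := by
  obtain ⟨C, hC, h⟩ := exists_dilate_le (scaleDeriv φ) 1
  simp only [convOp_apply]
  rw [← integral_const_mul]
  have hs2 : 0 < s / 2 := by positivity
  refine (hasDerivAt_integral_of_dominated_loc_of_deriv_le (s := Ioi (s / 2))
    (F := fun s y => dilate φ s (x - y) * w y)
    (F' := fun s y => s⁻¹ * (dilate (scaleDeriv φ) s (x - y) * w y))
    (bound := fun y => C * (((s / 2 + ‖x - y‖) ^ (n + 1))⁻¹ * ‖w y‖))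
    (Ioi_mem_nhds (by linarith)) ?_ (hw.integrable_dilate_mul φ hs x) ?_ ?_ ?_ ?_).2
  · filter_upwards [Ioi_mem_nhds hs] with σ hσ
    exact (hw.integrable_dilate_mul φ hσ x).1
  · exact ((hw.integrable_dilate_mul (scaleDeriv φ) hs x).const_mul _).1
  · refine Eventually.of_forall fun y σ hσ => ?_
    have hσ0 : 0 < σ := hs2.trans hσ
    have hσ1 : s / 2 < σ := hσ
    have h2 := h σ hσ0 (x - y)
    rw [norm_mul, norm_mul, norm_inv, Real.norm_eq_abs σ, abs_of_pos hσ0, ← mul_assoc, ← mul_assoc]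
    refine mul_le_mul_of_nonneg_right ?_ (norm_nonneg _)
    calc _ ≤ σ⁻¹ * (C * (σ ^ 1 * ((σ + ‖x - y‖) ^ (n + 1))⁻¹)) := by
            refine mul_le_mul_of_nonneg_left h2 (by positivity)
      _ = C * ((σ + ‖x - y‖) ^ (n + 1))⁻¹ := by rw [pow_one]; field_simp
      _ ≤ _ := by gcongr
  · exact (hw.integrable_weight hs2 x).const_mul C
  · refine Eventually.of_forall fun y σ hσ => ?_
    have := (hasDerivAt_dilate φ (x - y) (hs2.trans hσ)).mul_const (w y)
    rwa [mul_assoc] at this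

/-- Φ_s 1 does not depend on s; its derivative at s = 1 is this integral. -/
lemma integral_scaleDeriv (φ : 𝓢(𝔼, ℝ)) : ∫ z, scaleDeriv φ z = 0 := by
  have h1 := hasDerivAt_convOp φ one_pos (tailIntegrable_const (1 : ℝ)) (0 : 𝔼)
  have h2 : HasDerivAt (fun s => convOp φ s (fun _ => 1) (0 : 𝔼)) 0 1 := by
    refine (hasDerivAt_const (1 : ℝ) ((∫ z, φ z) * 1)).congr_of_eventuallyEq ?_
    filter_upwards [Ioi_mem_nhds one_pos] with s hs
    exact convOp_const φ hs 1 0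
  have h3 := h1.unique h2
  rwa [convOp_const _ one_pos, inv_one, one_mul, mul_one] at h3

lemma convOp_congr (φ : 𝔼 → ℝ) (s : ℝ) {v w : 𝔼 → ℝ} (h : v =ᵐ[volume] w) :
    convOp φ s v = convOp φ s w := by
  ext x
  rw [convOp_apply, convOp_apply]
  refine integral_congr_ae ?_
  filter_upwards [h] with y hy
  rw [hy]

lemma measurable_convOp (φ : 𝓢(𝔼, ℝ)) {w : 𝔼 → ℝ} (hw : AEStronglyMeasurable w) :
    Measurable fun p : ℝ × 𝔼 => convOp φ p.1 w p.2 := by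
  have hm := hw.stronglyMeasurable_mk.measurable
  have hd := measurable_dilate φ
  have e : (fun p : ℝ × 𝔼 => convOp φ p.1 w p.2) =
      fun p : ℝ × 𝔼 => ∫ y, dilate φ p.1 (p.2 - y) * hw.mk w y := by
    ext p
    rw [convOp_congr φ p.1 hw.ae_eq_mk, convOp_apply]
  rw [e]
  have : Measurable fun q : (ℝ × 𝔼) × 𝔼 => dilate φ q.1.1 (q.1.2 - q.2) * hw.mk w q.2 :=
    (hd.comp (f := fun q : (ℝ × 𝔼) × 𝔼 => (q.1.1, q.1.2 - q.2)) (by fun_prop)).mul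
      (hm.comp measurable_snd)
  exact (this.stronglyMeasurable.integral_prod_right').measurable

/-- The majorant s (s + |z|)^{-(n+1)} of the kernel is a dyadic sum of normalised indicators of
balls with coefficients of order 2^{-k}. -/
lemma exists_enorm_convOp_le_maximalFn (φ : 𝓢(𝔼, ℝ)) : ∃ C : ℝ≥0, ∀ s : ℝ, 0 < s →
    ∀ w : 𝔼 → ℝ, AEStronglyMeasurable w → ∀ x,
      ‖convOp φ s w x‖ₑ ≤ C * maximalFn (fun y => ‖w y‖ₑ) x := by
  obtain ⟨C, hC, h⟩ := exists_dilate_le φ 1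
  set D : ℝ≥0∞ := ∑' k : ℕ, ENNReal.ofReal (C * 2 ^ (n + 1) * (1 / 2) ^ k) *
    volume (ball (0 : 𝔼) 1) with hD
  have hDt : D ≠ ∞ := by
    rw [hD, ENNReal.tsum_mul_right]
    refine ENNReal.mul_ne_top (Summable.tsum_ofReal_ne_top ?_) (volume_ball_ne_top _)
    exact summable_geometric_two.mul_left _
  refine ⟨D.toNNReal, fun s hs w hw x => ?_⟩
  rw [ENNReal.coe_toNNReal hDt, convOp_apply]
  calc _ ≤ ∫⁻ y, ‖dilate φ s (x - y) * w y‖ₑ := enorm_integral_le_lintegral_enorm _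
    _ ≤ ∫⁻ y, ENNReal.ofReal (C * s) *
          (‖w y‖ₑ * ENNReal.ofReal (((s + ‖y - x‖) ^ (n + 1))⁻¹)) := by
        refine lintegral_mono fun y => ?_
        rw [enorm_mul, mul_comm ‖w y‖ₑ, ← mul_assoc, ← ENNReal.ofReal_mul (by positivity)]
        gcongr
        rw [Real.enorm_eq_ofReal_abs]
        refine ENNReal.ofReal_le_ofReal ((h s hs _).trans (le_of_eq ?_))
        rw [pow_one, ← mul_assoc, norm_sub_rev]
    _ = ENNReal.ofReal (C * s) *
          ∫⁻ y, ‖w y‖ₑ * ENNReal.ofReal (((s + ‖y - x‖) ^ (n + 1))⁻¹) :=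
        lintegral_const_mul' _ _ ENNReal.ofReal_ne_top
    _ ≤ ENNReal.ofReal (C * s) * ∑' k : ℕ, ENNReal.ofReal (2 ^ (n + 1) *
          ((2 ^ k * s) ^ (n + 1))⁻¹) * ∫⁻ y in ball x (2 ^ k * s), ‖w y‖ₑ := by
        gcongr
        exact lintegral_mul_inv_pow_le _ hw.enorm x hs (n + 1)
    _ ≤ _ := by
        rw [hD, ← ENNReal.tsum_mul_left, ← ENNReal.tsum_mul_right]
        refine ENNReal.tsum_le_tsum fun k => ?_
        have hk : (0 : ℝ) < 2 ^ k * s := by positivity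
        have h1 := lintegral_ball_le_maximalFn (fun y => ‖w y‖ₑ) x hk
        rw [volume_ball_eq x hk] at h1
        refine (mul_le_mul_right (mul_le_mul_right h1 _) _).trans (le_of_eq ?_)
        have e : ENNReal.ofReal (C * s) * (ENNReal.ofReal (2 ^ (n + 1) *
            ((2 ^ k * s) ^ (n + 1))⁻¹) * ENNReal.ofReal ((2 ^ k * s) ^ n)) =
            ENNReal.ofReal (C * 2 ^ (n + 1) * (1 / 2) ^ k) := by
          rw [← ENNReal.ofReal_mul (by positivity), ← ENNReal.ofReal_mul (by positivity)]
          congr 1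
          rw [pow_succ (2 ^ k * s), one_div, inv_pow]
          field_simp
        rw [← e]; ring

end Kernels

/-! ### Plancherel and bounds for the multipliers -/

section Fourier

open FourierTransform

variable {n : ℕ}

local notation "𝔼" => EuclideanSpace ℝ (Fin n)

/-- Both transforms agree when tested against smooth compactly supported functions: the L² one
through tempered distributions, the integral one through the multiplication formula. -/
lemma fourier_toLp_ae_eq {u : 𝔼 → ℂ} (hu : Integrable u) (hu2 : MemLp u 2) :
    (𝓕 (hu2.toLp u) : Lp (α := 𝔼) ℂ 2) =ᵐ[volume] 𝓕 u := by
  have hcont : Continuous (𝓕 u) :=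
    VectorFourier.fourierIntegral_continuous Real.continuous_fourierChar
      (by exact continuous_inner) hu
  have hloc : LocallyIntegrable (𝓕 (hu2.toLp u) : Lp (α := 𝔼) ℂ 2 volume) volume :=
    (Lp.memLp (𝓕 (hu2.toLp u) : Lp (α := 𝔼) ℂ 2 volume)).locallyIntegrable (by norm_num)
  refine ae_eq_of_integral_contDiff_smul_eq hloc hcont.locallyIntegrable fun g hg hgc => ?_
  have hgc' : HasCompactSupport fun x => (g x : ℂ) := hgc.comp_left (g := Complex.ofReal) (by simp)
  have hg' : ContDiff ℝ (⊤ : ℕ∞) fun x => (g x : ℂ) := Complex.ofRealCLM.contDiff.comp hg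
  set G : 𝓢(𝔼, ℂ) := hgc'.toSchwartzMap hg' with hG
  have hGg : ∀ x, G x = (g x : ℂ) := fun x => rfl
  have h1 := congrArg (fun T => T G) (Lp.fourier_toTemperedDistribution_eq (hu2.toLp u))
  simp only [TemperedDistribution.fourier_apply, Lp.toTemperedDistribution_apply] at h1
  have h2 : ∫ x, (𝓕 G) x • (hu2.toLp u : 𝔼 → ℂ) x = ∫ x, (𝓕 G) x • u x := by
    refine integral_congr_ae ?_
    filter_upwards [hu2.coeFn_toLp] with x hx
    rw [hx]
  have h3 : ∫ x, (𝓕 G) x • u x = ∫ x, G x • 𝓕 u x := by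
    have := VectorFourier.integral_fourierIntegral_smul_eq_flip (μ := (volume : Measure 𝔼))
      (ν := (volume : Measure 𝔼)) (L := innerₗ 𝔼) Real.continuous_fourierChar
      (by exact continuous_inner) G.integrable hu
    rw [flip_innerₗ] at this
    exact this
  simp only [hGg, Complex.coe_smul] at h1 h3
  rw [← h1, h2, h3]

/-- The Fourier transform of a real function. -/
noncomputable def realFourier (w : 𝔼 → ℝ) : 𝔼 → ℂ := 𝓕 fun x => (w x : ℂ)

lemma lintegral_realFourier_sq {w : 𝔼 → ℝ} (hw : Integrable w) (hw2 : MemLp w 2) :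
    ∫⁻ ξ, ‖realFourier w ξ‖ₑ ^ 2 = ∫⁻ x, ‖w x‖ₑ ^ 2 := by
  have hu : Integrable fun x => (w x : ℂ) := hw.ofReal
  have hu2 : MemLp (fun x => (w x : ℂ)) 2 := hw2.ofReal
  have h1 := Lp.norm_fourier_eq (hu2.toLp)
  rw [Lp.norm_def, Lp.norm_def, ENNReal.toReal_eq_toReal_iff' (Lp.eLpNorm_ne_top _)
    (Lp.eLpNorm_ne_top _), eLpNorm_congr_ae (fourier_toLp_ae_eq hu hu2),
    eLpNorm_congr_ae hu2.coeFn_toLp] at h1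
  have key : ∀ v : 𝔼 → ℂ, eLpNorm v 2 volume ^ 2 = ∫⁻ x, ‖v x‖ₑ ^ 2 := by
    intro v
    have := eLpNorm_nnreal_pow_eq_lintegral (f := v) (μ := volume) (p := 2) (by norm_num)
    norm_num at this
    exact this
  have h2 := congrArg (· ^ 2) h1
  simp only [key] at h2
  rw [realFourier, h2]
  refine lintegral_congr fun x => ?_
  rw [← ofReal_norm, Complex.norm_real, ofReal_norm]

lemma realFourier_sub {v w : 𝔼 → ℝ} (hv : Integrable v) (hw : Integrable w) (ξ : 𝔼) :
    realFourier (fun y => v y - w y) ξ = realFourier v ξ - realFourier w ξ := by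
  simp only [realFourier, Real.fourier_eq, Complex.ofReal_sub, smul_sub]
  exact integral_sub ((Real.fourierIntegral_convergent_iff ξ).2 hv.ofReal)
    ((Real.fourierIntegral_convergent_iff ξ).2 hw.ofReal)

lemma continuous_realFourier {w : 𝔼 → ℝ} (hw : Integrable w) : Continuous (realFourier w) :=
  VectorFourier.fourierIntegral_continuous Real.continuous_fourierChar
      (by exact continuous_inner) hw.ofReal

/-- The Fourier transform of a real Schwartz function, as a Schwartz function. -/
noncomputable def symbol (φ : 𝓢(𝔼, ℝ)) : 𝓢(𝔼, ℂ) := 𝓕 (φ.postcompCLM Complex.ofRealCLM)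

lemma symbol_apply (φ : 𝓢(𝔼, ℝ)) (ξ : 𝔼) : symbol φ ξ = realFourier φ ξ := rfl

lemma symbol_zero (φ : 𝓢(𝔼, ℝ)) : symbol φ 0 = ((∫ x, φ x : ℝ) : ℂ) := by
  rw [symbol_apply, realFourier, Real.fourier_eq]
  simp only [inner_zero_right, neg_zero, AddChar.map_zero_eq_one, one_smul]
  exact integral_ofReal

lemma realFourier_dilate (φ : 𝓢(𝔼, ℝ)) {s : ℝ} (hs : 0 < s) (ξ : 𝔼) :
    realFourier (dilate φ s) ξ = symbol φ (s • ξ) := by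
  rw [symbol_apply, realFourier, realFourier, Real.fourier_eq, Real.fourier_eq]
  have h := Measure.integral_comp_smul (volume : Measure 𝔼)
    (fun v : 𝔼 => Real.fourierChar (-inner ℝ v (s • ξ)) • (φ v : ℂ)) s⁻¹
  have e : ∀ v : 𝔼, inner ℝ (s⁻¹ • v) (s • ξ) = inner ℝ v ξ := by
    intro v
    rw [real_inner_smul_left, real_inner_smul_right, ← mul_assoc, inv_mul_cancel₀ hs.ne', one_mul]
  simp only [e, finrank_euclideanSpace_fin] at h
  have e2 : ∀ v : 𝔼, Real.fourierChar (-inner ℝ v ξ) • ((dilate φ s v : ℝ) : ℂ) =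
      ((s ^ n)⁻¹ : ℝ) • (Real.fourierChar (-inner ℝ v ξ) • (φ (s⁻¹ • v) : ℂ)) := by
    intro v
    rw [dilate, Complex.ofReal_mul, smul_comm, Complex.real_smul]
  simp_rw [e2]
  rw [integral_smul, h, smul_smul, inv_pow, inv_inv, abs_of_pos (by positivity),
    inv_mul_cancel₀ (by positivity), one_smul]

lemma integrable_dilate (φ : 𝓢(𝔼, ℝ)) {s : ℝ} (hs : 0 < s) : Integrable (dilate φ s) :=
  (φ.integrable.comp_smul (inv_ne_zero hs.ne')).const_mul _

lemma integrable_convOp (φ : 𝓢(𝔼, ℝ)) {s : ℝ} (hs : 0 < s) {w : 𝔼 → ℝ} (hw : Integrable w) :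
    Integrable (convOp φ s w) :=
  (integrable_dilate φ hs).integrable_convolution _ hw

/-- The convolution is both integrable and bounded, hence square integrable. -/
lemma memLp_two_convOp (φ : 𝓢(𝔼, ℝ)) {s : ℝ} (hs : 0 < s) {w : 𝔼 → ℝ} (hw : Integrable w) :
    MemLp (convOp φ s w) 2 := by
  have hi := integrable_convOp φ hs hw
  obtain ⟨C, hC, h⟩ := exists_dilate_le φ 0
  rw [memLp_two_iff_integrable_sq hi.1]
  have hb : ∀ x, ‖convOp φ s w x‖ ≤ C * (s ^ n)⁻¹ * ∫ y, ‖w y‖ := by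
    intro x
    rw [convOp_apply, ← integral_const_mul]
    refine (norm_integral_le_integral_norm _).trans (integral_mono_of_nonneg
      (Eventually.of_forall fun y => norm_nonneg _) (hw.norm.const_mul _)
      (Eventually.of_forall fun y => ?_))
    simp only [norm_mul]
    gcongr
    refine (h s hs _).trans ?_
    rw [pow_zero, one_mul, add_zero]
    gcongr
    linarith [norm_nonneg (x - y)]
  have := hi.bdd_mul hi.1 (Eventually.of_forall hb)
  refine this.congr (Eventually.of_forall fun x => ?_)
  simp only; ring

lemma realFourier_convOp (φ : 𝓢(𝔼, ℝ)) {s : ℝ} (hs : 0 < s) {w : 𝔼 → ℝ} (hw : Integrable w)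
    (ξ : 𝔼) : realFourier (convOp φ s w) ξ = symbol φ (s • ξ) * realFourier w ξ := by
  rw [← realFourier_dilate φ hs]
  have h := Real.fourier_mul_convolution_eq (integrable_dilate φ hs).ofReal hw.ofReal (R := ℂ) ξ
  refine Eq.trans ?_ h
  refine congrFun (congrArg 𝓕 (funext fun x => ?_)) ξ
  simp only [convOp, convolution, ContinuousLinearMap.lsmul_apply, ContinuousLinearMap.mul_apply',
    smul_eq_mul]
  rw [← integral_complex_ofReal]
  simp only [Complex.ofReal_mul]
  rfl

lemma div_one_add_sq_bound {u C D : ℝ} (hu : 0 ≤ u) {x : ℝ} (h1 : x ≤ C * u)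
    (h2 : x ≤ D * ((1 + u) ^ 2)⁻¹) (hC : 0 ≤ C) (hD : 0 ≤ D) :
    x ≤ (4 * C + D) * (u / (1 + u) ^ 2) := by
  have hp : 0 < (1 + u) ^ 2 := by positivity
  rw [← mul_div_assoc, le_div_iff₀ hp]
  rcases le_total u 1 with h | h
  · have : x * (1 + u) ^ 2 ≤ C * u * (1 + u) ^ 2 := by gcongr
    have h4 : (1 + u) ^ 2 ≤ 4 := by nlinarith
    have : C * u * (1 + u) ^ 2 ≤ C * u * 4 := by gcongr
    nlinarith [mul_nonneg hD hu]
  · rw [← div_eq_mul_inv, le_div_iff₀ hp] at h2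
    nlinarith [mul_nonneg hC hu]

lemma exists_norm_symbol_le (φ : 𝓢(𝔼, ℝ)) : ∃ C : ℝ, 0 < C ∧ ∀ η, ‖symbol φ η‖ ≤ C / (1 + ‖η‖) := by
  obtain ⟨C, hC, h⟩ := (symbol φ).exists_norm_le_inv_pow 1
  exact ⟨C, hC, fun η => by simpa [div_eq_mul_inv] using h η⟩

lemma exists_norm_symbol_sub_le (φ : 𝓢(𝔼, ℝ)) :
    ∃ C : ℝ, 0 < C ∧ ∀ η, ‖symbol φ η - symbol φ 0‖ ≤ C * ‖η‖ := by
  obtain ⟨C, hC, h⟩ := (symbol φ).exists_norm_fderiv_le_inv_pow 0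
  refine ⟨C, hC, fun η => ?_⟩
  have := convex_univ.norm_image_sub_le_of_norm_fderiv_le (𝕜 := ℝ)
    (fun x _ => (symbol φ).differentiableAt) (fun x _ => by simpa using h x)
    (mem_univ (0 : 𝔼)) (mem_univ η)
  simpa using this

/-- The normalisation of `φ` makes `symbol φ 0` equal to 1, which gives the linear vanishing at the
origin; elsewhere boundedness suffices. -/
lemma exists_norm_one_sub_symbol_le (φ : 𝓢(𝔼, ℝ)) (hφ : ∫ x, φ x = 1) :
    ∃ C : ℝ, 0 < C ∧ ∀ η, ‖1 - symbol φ η‖ ≤ C * (‖η‖ / (1 + ‖η‖)) := by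
  obtain ⟨C, hC, h⟩ := exists_norm_symbol_le φ
  obtain ⟨D, hD, h'⟩ := exists_norm_symbol_sub_le φ
  refine ⟨2 * D + 2 * (1 + C), by positivity, fun η => ?_⟩
  have e : symbol φ 0 = 1 := by rw [symbol_zero, hφ]; simp
  have h1 := h' η
  rw [e, norm_sub_rev] at h1
  have h2 : ‖1 - symbol φ η‖ ≤ 1 + C := by
    refine (norm_sub_le _ _).trans ?_
    rw [norm_one]
    gcongr
    refine (h η).trans (div_le_self hC.le ?_)
    linarith [norm_nonneg η]
  have hη := norm_nonneg η
  rw [← mul_div_assoc, le_div_iff₀ (by positivity)]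
  rcases le_total ‖η‖ 1 with h3 | h3
  · nlinarith [norm_nonneg (1 - symbol φ η), mul_nonneg hC.le hη, mul_nonneg hD.le hη]
  · nlinarith [norm_nonneg (1 - symbol φ η), mul_nonneg hC.le hη, mul_nonneg hD.le hη]

/-- Mean zero gives linear vanishing at the origin, and Schwartz decay handles large frequencies. -/
lemma exists_norm_symbol_scaleDeriv_le (φ : 𝓢(𝔼, ℝ)) :
    ∃ C : ℝ, 0 < C ∧ ∀ η, ‖symbol (scaleDeriv φ) η‖ ≤ C * (‖η‖ / (1 + ‖η‖) ^ 2) := by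
  obtain ⟨C, hC, h⟩ := (symbol (scaleDeriv φ)).exists_norm_le_inv_pow 2
  obtain ⟨D, hD, h'⟩ := exists_norm_symbol_sub_le (scaleDeriv φ)
  refine ⟨4 * D + C, by positivity, fun η => ?_⟩
  have e : symbol (scaleDeriv φ) 0 = 0 := by rw [symbol_zero, integral_scaleDeriv]; simp
  have h1 := h' η
  rw [e, sub_zero] at h1
  exact div_one_add_sq_bound (norm_nonneg η) h1 (h η) hD.le hC.le

/-- The symbols at comparable scales differ by a telescoping quantity. -/
lemma exists_norm_symbol_sub_symbol_le (φ : 𝓢(𝔼, ℝ)) : ∃ C : ℝ, 0 < C ∧ ∀ (ξ : 𝔼) (b a : ℝ),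
    0 < b → b ≤ a → ‖symbol φ (a • ξ) - symbol φ (b • ξ)‖ ≤
      C * ((1 + b * ‖ξ‖)⁻¹ - (1 + a * ‖ξ‖)⁻¹) := by
  obtain ⟨C, hC, h⟩ := (symbol φ).exists_norm_fderiv_le_inv_pow 2
  refine ⟨C, hC, fun ξ b a hb hba => ?_⟩
  have hd : ∀ s : ℝ, HasDerivAt (fun s : ℝ => symbol φ (s • ξ) - symbol φ (b • ξ))
      (fderiv ℝ (symbol φ) (s • ξ) ξ) s := by
    intro s
    have h1 : HasDerivAt (fun s : ℝ => s • ξ) ξ s := by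
      simpa using (hasDerivAt_id s).smul_const ξ
    exact (((symbol φ).hasFDerivAt (s • ξ)).comp_hasDerivAt s h1).sub_const _
  have hB : ∀ s ∈ Icc b a, HasDerivAt (fun s : ℝ => C * ((1 + b * ‖ξ‖)⁻¹ - (1 + s * ‖ξ‖)⁻¹))
      (C * (‖ξ‖ / (1 + s * ‖ξ‖) ^ 2)) s := by
    intro s hs
    have hs0 : 0 < 1 + s * ‖ξ‖ := by
      have : 0 < s := hb.trans_le hs.1
      positivity
    have h1 : HasDerivAt (fun s : ℝ => 1 + s * ‖ξ‖) ‖ξ‖ s := by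
      simpa using ((hasDerivAt_id s).mul_const ‖ξ‖).const_add 1
    have h2 := ((h1.inv hs0.ne').const_sub ((1 + b * ‖ξ‖)⁻¹)).const_mul C
    refine h2.congr_deriv ?_
    ring
  refine image_norm_le_of_norm_deriv_right_le_deriv_boundary'
    (f := fun s : ℝ => symbol φ (s • ξ) - symbol φ (b • ξ)) (a := b) (b := a)
    (f' := fun s => fderiv ℝ (symbol φ) (s • ξ) ξ)
    (fun s _ => (hd s).continuousAt.continuousWithinAt) (fun s _ => (hd s).hasDerivWithinAt)
    (B := fun s : ℝ => C * ((1 + b * ‖ξ‖)⁻¹ - (1 + s * ‖ξ‖)⁻¹))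
    (B' := fun s => C * (‖ξ‖ / (1 + s * ‖ξ‖) ^ 2)) (by simp)
    (fun s hs => (hB s hs).continuousAt.continuousWithinAt)
    (fun s hs => (hB s ⟨hs.1, hs.2.le⟩).hasDerivWithinAt) ?_ (right_mem_Icc.2 hba)
  intro s hs
  have hs0 : 0 < s := hb.trans_le hs.1
  have h1 := h (s • ξ)
  rw [norm_smul, Real.norm_eq_abs, abs_of_pos hs0] at h1
  refine (ContinuousLinearMap.le_opNorm _ _).trans ?_
  calc _ ≤ C * ((1 + s * ‖ξ‖) ^ 2)⁻¹ * ‖ξ‖ := by gcongr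
    _ = _ := by ring

end Fourier

/-! ### The L² bound for the oscillation -/

section OscillationL2

variable {n : ℕ}

local notation "𝔼" => EuclideanSpace ℝ (Fin n)

lemma enorm_sq_eq_ofReal (y : ℝ) : ‖y‖ₑ ^ 2 = ENNReal.ofReal (y ^ 2) := by
  rw [Real.enorm_eq_ofReal_abs, ← ENNReal.ofReal_pow (abs_nonneg _), sq_abs]

/-- A one-dimensional Sobolev bound: F(s)² = F(a)² - ∫_s^a 2FP dσ/σ and -2FP ≤ F² + P². It turns a
supremum over scales into an integral, to which Plancherel applies. -/
lemma enorm_sq_le_add_lintegral {F P : ℝ → ℝ} {b a s : ℝ} (hb : 0 < b) (hs : b ≤ s) (hsa : s ≤ a)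
    (hF : ∀ σ, 0 < σ → HasDerivAt F (σ⁻¹ * P σ) σ) (hP : ∀ σ, 0 < σ → ContinuousAt P σ) :
    ‖F s‖ₑ ^ 2 ≤ ‖F a‖ₑ ^ 2 +
      ∫⁻ σ in Ioc b a, ENNReal.ofReal σ⁻¹ * (‖F σ‖ₑ ^ 2 + ‖P σ‖ₑ ^ 2) := by
  have hs0 : 0 < s := hb.trans_le hs
  have hpos : ∀ σ ∈ uIcc s a, 0 < σ := fun σ hσ => by
    rw [uIcc_of_le hsa] at hσ; exact hs0.trans_le hσ.1
  have hc1 : ContinuousOn (fun σ => 2 * F σ * (σ⁻¹ * P σ)) (uIcc s a) := fun σ hσ =>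
    (((hF σ (hpos σ hσ)).continuousAt.const_mul 2).mul
      ((continuousAt_inv₀ (hpos σ hσ).ne').mul (hP σ (hpos σ hσ)))).continuousWithinAt
  have hc2 : ContinuousOn (fun σ => σ⁻¹ * (F σ ^ 2 + P σ ^ 2)) (uIcc s a) := fun σ hσ =>
    ((continuousAt_inv₀ (hpos σ hσ).ne').mul (((hF σ (hpos σ hσ)).continuousAt.pow 2).add
      ((hP σ (hpos σ hσ)).pow 2))).continuousWithinAt
  have hftc : ∫ σ in s..a, 2 * F σ * (σ⁻¹ * P σ) = F a ^ 2 - F s ^ 2 := by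
    refine intervalIntegral.integral_eq_sub_of_hasDerivAt (f := fun σ => F σ ^ 2)
      (fun σ hσ => ?_) hc1.intervalIntegrable
    have := (hF σ (hpos σ hσ)).pow 2
    simpa using! this
  have hle : -(F a ^ 2 - F s ^ 2) ≤ ∫ σ in s..a, σ⁻¹ * (F σ ^ 2 + P σ ^ 2) := by
    rw [← hftc, ← intervalIntegral.integral_neg]
    refine intervalIntegral.integral_mono_on hsa hc1.neg.intervalIntegrable hc2.intervalIntegrable
      fun σ hσ => ?_
    have h0 : 0 < σ⁻¹ := inv_pos.2 (hs0.trans_le hσ.1)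
    nlinarith [mul_nonneg h0.le (sq_nonneg (F σ + P σ))]
  rw [enorm_sq_eq_ofReal, enorm_sq_eq_ofReal]
  calc ENNReal.ofReal (F s ^ 2)
      ≤ ENNReal.ofReal (F a ^ 2 + ∫ σ in s..a, σ⁻¹ * (F σ ^ 2 + P σ ^ 2)) :=
        ENNReal.ofReal_le_ofReal (by linarith)
    _ ≤ ENNReal.ofReal (F a ^ 2) +
          ENNReal.ofReal (∫ σ in s..a, σ⁻¹ * (F σ ^ 2 + P σ ^ 2)) := ENNReal.ofReal_add_le
    _ ≤ _ := by
        gcongr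
        rw [intervalIntegral.integral_of_le hsa, ofReal_integral_eq_lintegral_ofReal]
        · refine (lintegral_mono_set (Ioc_subset_Ioc_left hs)).trans (le_of_eq ?_)
          refine setLIntegral_congr_fun measurableSet_Ioc fun σ hσ => ?_
          have h0 : 0 < σ⁻¹ := inv_pos.2 (hb.trans hσ.1)
          simp only [enorm_sq_eq_ofReal]
          rw [ENNReal.ofReal_mul h0.le, ENNReal.ofReal_add (sq_nonneg _) (sq_nonneg _)]
        · have := hc2.intervalIntegrable (μ := volume)
          rwa [intervalIntegrable_iff_integrableOn_Ioc_of_le hsa] at this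
        · filter_upwards [self_mem_ae_restrict measurableSet_Ioc] with σ hσ
          have h0 : 0 < σ⁻¹ := inv_pos.2 (hs0.trans hσ.1)
          simp only [Pi.zero_apply]
          positivity

/-- The contribution of one interval `[b, a]` to the (squared) oscillation. -/
noncomputable def oscBlock (b a : ℝ) (G : ℝ → ℝ) : ℝ≥0∞ :=
  ⨆ (ε : ℝ) (δ : ℝ) (_ : b ≤ δ ∧ δ < ε ∧ ε ≤ a), ‖G ε - G δ‖ₑ ^ 2

lemma oscBlock_le {b a : ℝ} {G : ℝ → ℝ} {B : ℝ≥0∞}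
    (h : ∀ s, b ≤ s → s ≤ a → ‖G s - G a‖ₑ ^ 2 ≤ B) : oscBlock b a G ≤ 4 * B := by
  refine iSup_le fun ε => iSup_le fun δ => iSup_le fun hεδ => ?_
  obtain ⟨h1, h2, h3⟩ := hεδ
  refine (enorm_sub_sq_le _ (G a) _).trans ?_
  rw [enorm_sub_rev (G a)]
  calc _ ≤ 2 * B + 2 * B := by
        gcongr
        · exact h ε (by linarith) h3
        · exact h δ h1 (by linarith)
    _ = _ := by ring

/-- The supremum is uncountable, but of continuous functions of x, hence lower semicontinuous. -/
lemma measurable_oscBlock_convOp (φ : 𝓢(𝔼, ℝ)) {b a : ℝ} (hb : 0 < b) {w : 𝔼 → ℝ}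
    (hw : TailIntegrable w) : Measurable fun x => oscBlock b a fun s => convOp φ s w x := by
  refine LowerSemicontinuous.measurable ?_
  refine lowerSemicontinuous_iSup fun ε => lowerSemicontinuous_iSup fun δ =>
    lowerSemicontinuous_iSup fun h => Continuous.lowerSemicontinuous ?_
  have h1 := continuous_convOp φ (hb.trans_le h.1) hw
  have h2 := continuous_convOp φ ((hb.trans_le h.1).trans h.2.1) hw
  exact (ENNReal.continuous_pow 2).comp (h2.sub h1).enorm

/-- With w = f - g, the function F(σ) = Φ_σ w - Φ_a f has F(a) = -Φ_a g, so the endpoint term of the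
Sobolev bound is also controlled by M. -/
lemma oscBlock_convOp_le (φ : 𝓢(𝔼, ℝ)) {b a : ℝ} (hb : 0 < b) (hba : b ≤ a) {f g : 𝔼 → ℝ}
    (hf : TailIntegrable f) (hg : TailIntegrable g)
    {M : ℝ≥0∞} (x : 𝔼) (hM : ∀ s, 0 < s → ‖convOp φ s g x‖ₑ ≤ M) :
    oscBlock b a (fun s => convOp φ s f x) ≤ 16 * M ^ 2 + 8 * ∫⁻ σ in Ioc b a,
      ENNReal.ofReal σ⁻¹ * (‖convOp φ σ (fun y => f y - g y) x - convOp φ a f x‖ₑ ^ 2 +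
        ‖convOp (scaleDeriv φ) σ (fun y => f y - g y) x‖ₑ ^ 2) := by
  have ha : 0 < a := hb.trans_le hba
  set w : 𝔼 → ℝ := fun y => f y - g y with hw_def
  have hw : TailIntegrable w := hf.sub hg
  set J := ∫⁻ σ in Ioc b a, ENNReal.ofReal σ⁻¹ * (‖convOp φ σ w x - convOp φ a f x‖ₑ ^ 2 +
        ‖convOp (scaleDeriv φ) σ w x‖ₑ ^ 2) with hJ
  refine (oscBlock_le (B := 4 * M ^ 2 + 2 * J) fun s hs1 hs2 => ?_).trans (le_of_eq (by ring))
  have hs : 0 < s := hb.trans_le hs1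
  have hsub : ∀ σ, 0 < σ → convOp φ σ w x = convOp φ σ f x - convOp φ σ g x :=
    fun σ hσ => convOp_sub φ hσ hf hg x
  have h1 := enorm_sq_le_add_lintegral (F := fun σ => convOp φ σ w x - convOp φ a f x)
    (P := fun σ => convOp (scaleDeriv φ) σ w x) hb hs1 hs2
    (fun σ hσ => (hasDerivAt_convOp φ hσ hw x).sub_const _)
    (fun σ hσ => (hasDerivAt_convOp (scaleDeriv φ) hσ hw x).continuousAt)
  have e1 : convOp φ a w x - convOp φ a f x = -convOp φ a g x := by rw [hsub a ha]; ring
  simp only [e1, enorm_neg] at h1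
  have e2 : convOp φ s f x - convOp φ a f x =
      (convOp φ s w x - convOp φ a f x) - (-convOp φ s g x) := by rw [hsub s hs]; ring
  have h2 := enorm_sub_sq_le (convOp φ s w x - convOp φ a f x) 0 (-convOp φ s g x)
  simp only [sub_zero, zero_sub, neg_neg] at h2
  simp only [e2]
  refine h2.trans ?_
  calc _ ≤ 2 * (M ^ 2 + J) + 2 * M ^ 2 := by
        gcongr
        · refine h1.trans ?_
          gcongr
          exact hM a ha
        · exact hM s hs
    _ = _ := by ring

lemma lintegral_Ioc_div_one_add_sq {ρ b a : ℝ} (hρ : 0 ≤ ρ) (hb : 0 < b) (hba : b ≤ a) :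
    ∫⁻ σ in Ioc b a, ENNReal.ofReal (ρ / (1 + σ * ρ) ^ 2) =
      ENNReal.ofReal ((1 + b * ρ)⁻¹ - (1 + a * ρ)⁻¹) := by
  have hpos : ∀ σ ∈ uIcc b a, 0 < 1 + σ * ρ := fun σ hσ => by
    rw [uIcc_of_le hba] at hσ
    have : 0 < σ := hb.trans_le hσ.1
    positivity
  have hc : ContinuousOn (fun σ => ρ / (1 + σ * ρ) ^ 2) (uIcc b a) :=
    continuousOn_const.div (by fun_prop) fun σ hσ => (pow_pos (hpos σ hσ) 2).ne'
  rw [← ofReal_integral_eq_lintegral_ofReal, ← intervalIntegral.integral_of_le hba,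
    intervalIntegral.integral_eq_sub_of_hasDerivAt (f := fun σ => -(1 + σ * ρ)⁻¹)
      (fun σ hσ => ?_) hc.intervalIntegrable]
  · congr 1; ring
  · have h1 : HasDerivAt (fun s : ℝ => 1 + s * ρ) ρ σ := by
      simpa using ((hasDerivAt_id σ).mul_const ρ).const_add 1
    have h2 := (h1.inv (hpos σ hσ).ne').neg
    refine h2.congr_deriv ?_
    ring
  · have := hc.intervalIntegrable (μ := volume)
    rwa [intervalIntegrable_iff_integrableOn_Ioc_of_le hba] at this
  · refine Eventually.of_forall fun σ => ?_
    simp only [Pi.zero_apply]; positivity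

lemma tsum_telescoping_le {t : ℕ → ℝ} (ht : ∀ i, 0 < t i) (hanti : Antitone t) {ρ : ℝ}
    (hρ : 0 ≤ ρ) :
    ∑' i, ENNReal.ofReal ((1 + t (i + 1) * ρ)⁻¹ - (1 + t i * ρ)⁻¹) ≤ 1 := by
  refine ENNReal.tsum_le_of_sum_range_le fun N => ?_
  rw [← ENNReal.ofReal_sum_of_nonneg, Finset.sum_range_sub (fun i => (1 + t i * ρ)⁻¹),
    ← ENNReal.ofReal_one]
  · refine ENNReal.ofReal_le_ofReal ?_
    have h1 := ht N
    have h0 := ht 0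
    have h2 : (1 + t N * ρ)⁻¹ ≤ 1 := inv_le_one_of_one_le₀ (by nlinarith)
    have h3 : 0 ≤ (1 + t 0 * ρ)⁻¹ := by positivity
    linarith
  · intro i _
    have h1 := ht (i + 1)
    rw [sub_nonneg]
    have := hanti (Nat.le_succ i)
    gcongr

/-- One factor σρ / (1 + σρ)² of the square cancels σ⁻¹ and the other is at most 1; what is left is
the σ-derivative of -(1 + σρ)⁻¹. -/
lemma ofReal_inv_mul_enorm_sq_le {z u : ℂ} {σ ρ D : ℝ} (hσ : 0 < σ) (hρ : 0 ≤ ρ)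
    (h : ‖z‖ ≤ D * (σ * ρ / (1 + σ * ρ) ^ 2) * ‖u‖) :
    ENNReal.ofReal σ⁻¹ * ‖z‖ₑ ^ 2 ≤
      ENNReal.ofReal (D ^ 2) * (ENNReal.ofReal (ρ / (1 + σ * ρ) ^ 2) * ‖u‖ₑ ^ 2) := by
  rw [← ofReal_norm, ← ofReal_norm, ← ENNReal.ofReal_pow (norm_nonneg _),
    ← ENNReal.ofReal_pow (norm_nonneg _), ← ENNReal.ofReal_mul (by positivity),
    ← ENNReal.ofReal_mul (by positivity), ← ENNReal.ofReal_mul (by positivity)]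
  refine ENNReal.ofReal_le_ofReal ?_
  have hu : 0 ≤ σ * ρ := by positivity
  have h1 : σ * ρ / (1 + σ * ρ) ^ 2 ≤ 1 := by
    rw [div_le_one (by positivity)]; nlinarith
  calc σ⁻¹ * ‖z‖ ^ 2 ≤ σ⁻¹ * (D * (σ * ρ / (1 + σ * ρ) ^ 2) * ‖u‖) ^ 2 := by gcongr
    _ = D ^ 2 * (ρ / (1 + σ * ρ) ^ 2 * ‖u‖ ^ 2) * (σ * ρ / (1 + σ * ρ) ^ 2) := by
        field_simp
    _ ≤ D ^ 2 * (ρ / (1 + σ * ρ) ^ 2 * ‖u‖ ^ 2) * 1 := by gcongr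
    _ = _ := mul_one _

/-- The multiplier bounds behind the `L²` estimate: the multipliers of the difference `g` and of
the two error terms, on the interval `[b, a]` of scales. -/
lemma exists_multiplier_bounds (φ : 𝓢(𝔼, ℝ)) (hφ : ∫ x, φ x = 1) : ∃ D : ℝ, 0 < D ∧
    ∀ (f : 𝔼 → ℝ), Integrable f → ∀ b a σ : ℝ, 0 < b → b ≤ σ → σ ≤ a → ∀ ξ : 𝔼,
      ‖realFourier (fun y => convOp φ σ (fun y => f y - (convOp φ b f y - convOp φ a f y)) y -
        convOp φ a f y) ξ‖ ≤ D * (σ * ‖ξ‖ / (1 + σ * ‖ξ‖) ^ 2) * ‖realFourier f ξ‖ ∧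
      ‖realFourier (convOp (scaleDeriv φ) σ
        (fun y => f y - (convOp φ b f y - convOp φ a f y))) ξ‖ ≤
        D * (σ * ‖ξ‖ / (1 + σ * ‖ξ‖) ^ 2) * ‖realFourier f ξ‖ := by
  obtain ⟨C, hC, h⟩ := exists_norm_symbol_le φ
  obtain ⟨D, hD, h'⟩ := exists_norm_one_sub_symbol_le φ hφ
  obtain ⟨E, hE, h''⟩ := exists_norm_symbol_scaleDeriv_le φ
  refine ⟨2 * (C * D) + E * (1 + 2 * C), by positivity, fun f hf b a σ hb hbσ hσa ξ => ?_⟩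
  have hσ : 0 < σ := hb.trans_le hbσ
  have ha : 0 < a := hσ.trans_le hσa
  have hfb := integrable_convOp φ hb hf
  have hfa := integrable_convOp φ ha hf
  have hg : Integrable (fun y => convOp φ b f y - convOp φ a f y) := hfb.sub hfa
  have hw : Integrable (fun y => f y - (convOp φ b f y - convOp φ a f y)) := hf.sub hg
  have hnorm : ∀ s : ℝ, 0 < s → ‖s • ξ‖ = s * ‖ξ‖ := fun s hs => by
    rw [norm_smul, Real.norm_eq_abs, abs_of_pos hs]
  have hξ := norm_nonneg ξ
  have ew : realFourier (fun y => f y - (convOp φ b f y - convOp φ a f y)) ξ =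
      (1 - symbol φ (b • ξ) + symbol φ (a • ξ)) * realFourier f ξ := by
    rw [realFourier_sub hf hg, realFourier_sub hfb hfa, realFourier_convOp φ hb hf,
      realFourier_convOp φ ha hf]
    ring
  have p1 : ‖symbol φ (σ • ξ)‖ ≤ C / (1 + σ * ‖ξ‖) := by rw [← hnorm σ hσ]; exact h _
  have p2 : ‖symbol φ (a • ξ)‖ ≤ C / (1 + σ * ‖ξ‖) := by
    refine (h _).trans ?_
    rw [hnorm a ha]; gcongr
  have p3 : ‖1 - symbol φ (σ • ξ)‖ ≤ D * (σ * ‖ξ‖ / (1 + σ * ‖ξ‖)) := by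
    rw [← hnorm σ hσ]; exact h' _
  have p4 : ‖1 - symbol φ (b • ξ)‖ ≤ D * (σ * ‖ξ‖ / (1 + σ * ‖ξ‖)) := by
    refine (h' _).trans ?_
    rw [hnorm b hb]
    gcongr 1
    rw [div_le_div_iff₀ (by positivity) (by positivity)]
    nlinarith [mul_le_mul_of_nonneg_right hbσ hξ]
  have hK : 0 ≤ σ * ‖ξ‖ / (1 + σ * ‖ξ‖) ^ 2 := by positivity
  have hCle : ∀ η, ‖symbol φ η‖ ≤ C := fun η =>
    (h η).trans (div_le_self hC.le (by linarith [norm_nonneg η]))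
  constructor
  · rw [realFourier_sub (integrable_convOp φ hσ hw) hfa, realFourier_convOp φ hσ hw, ew,
      realFourier_convOp φ ha hf]
    -- In this form each product pairs a factor decaying in σ|ξ| with one vanishing at σ|ξ| = 0,
    -- thanks to b ≤ σ ≤ a.
    have e : symbol φ (σ • ξ) * ((1 - symbol φ (b • ξ) + symbol φ (a • ξ)) * realFourier f ξ) -
        symbol φ (a • ξ) * realFourier f ξ =
        (symbol φ (σ • ξ) * (1 - symbol φ (b • ξ)) - symbol φ (a • ξ) * (1 - symbol φ (σ • ξ))) *
          realFourier f ξ := by ring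
    rw [e, norm_mul]
    gcongr
    refine (norm_sub_le _ _).trans ?_
    rw [norm_mul, norm_mul]
    calc _ ≤ C / (1 + σ * ‖ξ‖) * (D * (σ * ‖ξ‖ / (1 + σ * ‖ξ‖))) +
          C / (1 + σ * ‖ξ‖) * (D * (σ * ‖ξ‖ / (1 + σ * ‖ξ‖))) := by gcongr
      _ = 2 * (C * D) * (σ * ‖ξ‖ / (1 + σ * ‖ξ‖) ^ 2) := by field_simp; ring
      _ ≤ _ := by
        gcongr
        have : 0 ≤ E * (1 + 2 * C) := by positivity
        linarith
  · rw [realFourier_convOp _ hσ hw, ew, ← mul_assoc, norm_mul]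
    gcongr
    rw [norm_mul]
    have p5 : ‖symbol (scaleDeriv φ) (σ • ξ)‖ ≤ E * (σ * ‖ξ‖ / (1 + σ * ‖ξ‖) ^ 2) := by
      rw [← hnorm σ hσ]; exact h'' _
    have p6 : ‖1 - symbol φ (b • ξ) + symbol φ (a • ξ)‖ ≤ 1 + 2 * C := by
      refine (norm_add_le _ _).trans ?_
      have := (norm_sub_le (1 : ℂ) (symbol φ (b • ξ)))
      rw [norm_one] at this
      linarith [hCle (b • ξ), hCle (a • ξ)]
    calc _ ≤ E * (σ * ‖ξ‖ / (1 + σ * ‖ξ‖) ^ 2) * (1 + 2 * C) := by gcongr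
      _ = E * (1 + 2 * C) * (σ * ‖ξ‖ / (1 + σ * ‖ξ‖) ^ 2) := by ring
      _ ≤ _ := by
        gcongr
        have : 0 ≤ 2 * (C * D) := by positivity
        linarith

/-- Tonelli, Plancherel in x for each fixed σ, then exact integration in σ at each frequency. -/
lemma exists_lintegral_error_le (φ : 𝓢(𝔼, ℝ)) (hφ : ∫ x, φ x = 1) : ∃ D : ℝ≥0,
    ∀ (f : 𝔼 → ℝ), Integrable f → MemLp f 2 → ∀ b a : ℝ, 0 < b → b ≤ a →
      ∫⁻ x, ∫⁻ σ in Ioc b a, ENNReal.ofReal σ⁻¹ *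
        (‖convOp φ σ (fun y => f y - (convOp φ b f y - convOp φ a f y)) x - convOp φ a f x‖ₑ ^ 2 +
        ‖convOp (scaleDeriv φ) σ (fun y => f y - (convOp φ b f y - convOp φ a f y)) x‖ₑ ^ 2) ≤
      D * ∫⁻ ξ, ENNReal.ofReal ((1 + b * ‖ξ‖)⁻¹ - (1 + a * ‖ξ‖)⁻¹) * ‖realFourier f ξ‖ₑ ^ 2 := by
  obtain ⟨D, hD, h⟩ := exists_multiplier_bounds φ hφ
  refine ⟨2 * (D ^ 2).toNNReal, fun f hf hf2 b a hb hba => ?_⟩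
  have ha : 0 < a := hb.trans_le hba
  have hfb := integrable_convOp φ hb hf
  have hfa := integrable_convOp φ ha hf
  set w : 𝔼 → ℝ := fun y => f y - (convOp φ b f y - convOp φ a f y) with hw_def
  have hw : Integrable w := hf.sub (hfb.sub hfa)
  have m1 := (measurable_convOp φ hw.1).comp measurable_swap
  have m2 := (measurable_convOp (scaleDeriv φ) hw.1).comp measurable_swap
  have m0 : Measurable (convOp φ a f) :=
    (continuous_convOp φ ha (TailIntegrable.of_integrable hf)).measurable
  have mF : Measurable (realFourier f) := (continuous_realFourier hf).measurable
  have m3 : Measurable fun p : 𝔼 × ℝ => ENNReal.ofReal p.2⁻¹ *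
      (‖convOp φ p.2 w p.1 - convOp φ a f p.1‖ₑ ^ 2 +
        ‖convOp (scaleDeriv φ) p.2 w p.1‖ₑ ^ 2) := by
    have m3a : Measurable fun p : 𝔼 × ℝ => ‖convOp φ p.2 w p.1 - convOp φ a f p.1‖ₑ ^ 2 :=
      ((m1.sub (m0.comp measurable_fst)).enorm).pow_const 2
    have m3b : Measurable fun p : 𝔼 × ℝ => ‖convOp (scaleDeriv φ) p.2 w p.1‖ₑ ^ 2 :=
      (m2.enorm).pow_const 2
    fun_prop
  have m4 : Measurable fun p : ℝ × 𝔼 => ENNReal.ofReal (‖p.2‖ / (1 + p.1 * ‖p.2‖) ^ 2) *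
      ‖realFourier f p.2‖ₑ ^ 2 := by fun_prop
  rw [lintegral_lintegral_swap m3.aemeasurable]
  calc _ ≤ ∫⁻ σ in Ioc b a, ((2 * (D ^ 2).toNNReal : ℝ≥0) : ℝ≥0∞) *
        ∫⁻ ξ, ENNReal.ofReal (‖ξ‖ / (1 + σ * ‖ξ‖) ^ 2) * ‖realFourier f ξ‖ₑ ^ 2 := by
        refine setLIntegral_mono' measurableSet_Ioc fun σ hσ => ?_
        have hσ0 : 0 < σ := hb.trans hσ.1
        have i1 := integrable_convOp φ hσ0 hw
        have l1 := memLp_two_convOp φ hσ0 hw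
        have i2 := integrable_convOp (scaleDeriv φ) hσ0 hw
        have l2 := memLp_two_convOp (scaleDeriv φ) hσ0 hw
        have l3 := memLp_two_convOp φ ha hf
        have P1 := lintegral_realFourier_sq (w := fun x => convOp φ σ w x - convOp φ a f x)
          (i1.sub hfa) (l1.sub l3)
        have P2 := lintegral_realFourier_sq i2 l2
        have c1 : Measurable fun x => ‖convOp φ σ w x - convOp φ a f x‖ₑ ^ 2 :=
          (((continuous_convOp φ hσ0 (TailIntegrable.of_integrable hw)).measurable.sub
            m0).enorm).pow_const 2
        have c2 : Continuous (realFourier fun x => convOp φ σ w x - convOp φ a f x) :=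
          continuous_realFourier (i1.sub hfa)
        have m5 : Measurable fun ξ : 𝔼 => ENNReal.ofReal (‖ξ‖ / (1 + σ * ‖ξ‖) ^ 2) *
          ‖realFourier f ξ‖ₑ ^ 2 := by fun_prop
        rw [lintegral_const_mul' _ _ ENNReal.ofReal_ne_top, lintegral_add_left c1, ← P1, ← P2,
          mul_add, ← lintegral_const_mul' _ _ ENNReal.ofReal_ne_top,
          ← lintegral_const_mul' _ _ ENNReal.ofReal_ne_top]
        have b1 := fun ξ => ofReal_inv_mul_enorm_sq_le hσ0 (norm_nonneg ξ)
          (h f hf b a σ hb hσ.1.le hσ.2 ξ).1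
        have b2 := fun ξ => ofReal_inv_mul_enorm_sq_le hσ0 (norm_nonneg ξ)
          (h f hf b a σ hb hσ.1.le hσ.2 ξ).2
        refine (add_le_add (lintegral_mono b1) (lintegral_mono b2)).trans (le_of_eq ?_)
        rw [lintegral_const_mul _ m5, ENNReal.ofReal, ENNReal.coe_mul]
        push_cast
        ring
    _ = _ := by
        have m6 : Measurable fun σ : ℝ =>
          ∫⁻ ξ : 𝔼, ENNReal.ofReal (‖ξ‖ / (1 + σ * ‖ξ‖) ^ 2) * ‖realFourier f ξ‖ₑ ^ 2 :=
          m4.lintegral_prod_right'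
        rw [lintegral_const_mul _ m6, lintegral_lintegral_swap m4.aemeasurable]
        congr 1
        refine lintegral_congr fun ξ => ?_
        rw [lintegral_mul_const' _ _ (ENNReal.pow_ne_top enorm_ne_top),
          lintegral_Ioc_div_one_add_sq (norm_nonneg ξ) hb hba]

/-- The multiplier is at most C d with d the telescoping weight; since 0 ≤ d ≤ 1, also d² ≤ d. -/
lemma exists_lintegral_convOp_sub_sq_le (φ : 𝓢(𝔼, ℝ)) : ∃ D : ℝ≥0,
    ∀ (f : 𝔼 → ℝ), Integrable f → MemLp f 2 → ∀ b a : ℝ, 0 < b → b ≤ a →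
      ∫⁻ x, ‖convOp φ b f x - convOp φ a f x‖ₑ ^ 2 ≤
      D * ∫⁻ ξ, ENNReal.ofReal ((1 + b * ‖ξ‖)⁻¹ - (1 + a * ‖ξ‖)⁻¹) * ‖realFourier f ξ‖ₑ ^ 2 := by
  obtain ⟨C, hC, h⟩ := exists_norm_symbol_sub_symbol_le φ
  refine ⟨(C ^ 2).toNNReal, fun f hf hf2 b a hb hba => ?_⟩
  have ha : 0 < a := hb.trans_le hba
  have hfb := integrable_convOp φ hb hf
  have hfa := integrable_convOp φ ha hf
  rw [← lintegral_realFourier_sq (w := fun x => convOp φ b f x - convOp φ a f x) (hfb.sub hfa)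
    ((memLp_two_convOp φ hb hf).sub (memLp_two_convOp φ ha hf)),
    ← lintegral_const_mul' _ _ ENNReal.coe_ne_top]
  refine lintegral_mono fun ξ => ?_
  rw [realFourier_sub hfb hfa, realFourier_convOp φ hb hf, realFourier_convOp φ ha hf, ← sub_mul,
    enorm_mul, mul_pow, ← mul_assoc]
  gcongr
  change _ ≤ ENNReal.ofReal (C ^ 2) * _
  have hd : 0 ≤ (1 + b * ‖ξ‖)⁻¹ - (1 + a * ‖ξ‖)⁻¹ := by
    rw [sub_nonneg]; gcongr
  have hd1 : (1 + b * ‖ξ‖)⁻¹ - (1 + a * ‖ξ‖)⁻¹ ≤ 1 := by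
    have h1 : (1 + b * ‖ξ‖)⁻¹ ≤ 1 := inv_le_one_of_one_le₀ (by
      have := mul_nonneg hb.le (norm_nonneg ξ); linarith)
    have h2 : 0 ≤ (1 + a * ‖ξ‖)⁻¹ := by positivity
    linarith
  rw [← ofReal_norm, ← ENNReal.ofReal_pow (norm_nonneg _), ← ENNReal.ofReal_mul (by positivity),
    norm_sub_rev]
  refine ENNReal.ofReal_le_ofReal ?_
  calc _ ≤ (C * ((1 + b * ‖ξ‖)⁻¹ - (1 + a * ‖ξ‖)⁻¹)) ^ 2 := by
        gcongr; exact h ξ b a hb hba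
    _ ≤ _ := by rw [mul_pow]; gcongr; nlinarith

/-- The `L²` bound for the oscillation operator. -/
theorem exists_lintegral_oscillation_sq_le (φ : 𝓢(𝔼, ℝ)) (hφ : ∫ x, φ x = 1) : ∃ D : ℝ≥0,
    ∀ t : ℕ → ℝ, (∀ i, 0 < t i) → Antitone t → ∀ f : 𝔼 → ℝ, Integrable f → MemLp f 2 →
      ∫⁻ x, ∑' i, oscBlock (t (i + 1)) (t i) (fun s => convOp φ s f x) ≤
        D * ∫⁻ x, ‖f x‖ₑ ^ 2 := by
  obtain ⟨A, hA⟩ := exists_enorm_convOp_le_maximalFn φ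
  obtain ⟨D₁, h₁⟩ := exists_lintegral_error_le φ hφ
  obtain ⟨D₂, h₂⟩ := exists_lintegral_convOp_sub_sq_le φ
  refine ⟨16 * A ^ 2 * ((8 * 5 ^ n : ℝ).toNNReal * D₂) + 8 * D₁, fun t ht hanti f hf hf2 => ?_⟩
  have htail := TailIntegrable.of_integrable hf
  rw [lintegral_tsum fun i => (measurable_oscBlock_convOp φ (ht (i + 1)) htail).aemeasurable]
  set K : ℝ≥0 := 16 * A ^ 2 * ((8 * 5 ^ n : ℝ).toNNReal * D₂) + 8 * D₁ with hK
  -- Both the maximal-function term and the error term of a block are bounded with the same weight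
  -- in ξ, so one telescoping sum handles both.
  have hblock : ∀ i, ∫⁻ x, oscBlock (t (i + 1)) (t i) (fun s => convOp φ s f x) ≤
      K * ∫⁻ ξ, ENNReal.ofReal ((1 + t (i + 1) * ‖ξ‖)⁻¹ - (1 + t i * ‖ξ‖)⁻¹) *
        ‖realFourier f ξ‖ₑ ^ 2 := by
    intro i
    have hb := ht (i + 1)
    have hba := hanti (Nat.le_succ i)
    have hcb := continuous_convOp φ hb htail
    have hca := continuous_convOp φ (ht i) htail
    set g : 𝔼 → ℝ := fun y => convOp φ (t (i + 1)) f y - convOp φ (t i) f y with hg_def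
    have hg : Integrable g := (integrable_convOp φ hb hf).sub (integrable_convOp φ (ht i) hf)
    have hgm : Measurable fun y => ‖g y‖ₑ := (hcb.sub hca).measurable.enorm
    have mM := measurable_maximalFn fun y => ‖g y‖ₑ
    calc _ ≤ ∫⁻ x, (16 * (A * maximalFn (fun y => ‖g y‖ₑ) x) ^ 2 +
          8 * ∫⁻ σ in Ioc (t (i + 1)) (t i), ENNReal.ofReal σ⁻¹ *
            (‖convOp φ σ (fun y => f y - g y) x - convOp φ (t i) f x‖ₑ ^ 2 +
              ‖convOp (scaleDeriv φ) σ (fun y => f y - g y) x‖ₑ ^ 2)) := by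
          refine lintegral_mono fun x => ?_
          exact oscBlock_convOp_le φ hb hba htail (TailIntegrable.of_integrable hg) x
            fun s hs => hA s hs g hg.1 x
      _ = 16 * A ^ 2 * (∫⁻ x, maximalFn (fun y => ‖g y‖ₑ) x ^ 2) +
          8 * ∫⁻ x, ∫⁻ σ in Ioc (t (i + 1)) (t i), ENNReal.ofReal σ⁻¹ *
            (‖convOp φ σ (fun y => f y - g y) x - convOp φ (t i) f x‖ₑ ^ 2 +
              ‖convOp (scaleDeriv φ) σ (fun y => f y - g y) x‖ₑ ^ 2) := by
          rw [lintegral_add_left (by fun_prop), lintegral_const_mul' _ _ (by norm_num),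
            lintegral_const_mul' _ _ (by norm_num)]
          simp_rw [mul_pow]
          rw [lintegral_const_mul' _ _ (by finiteness), mul_assoc]
      _ ≤ 16 * A ^ 2 * (ENNReal.ofReal (8 * 5 ^ n) * (D₂ * ∫⁻ ξ, ENNReal.ofReal
            ((1 + t (i + 1) * ‖ξ‖)⁻¹ - (1 + t i * ‖ξ‖)⁻¹) * ‖realFourier f ξ‖ₑ ^ 2)) +
          8 * (D₁ * ∫⁻ ξ, ENNReal.ofReal
            ((1 + t (i + 1) * ‖ξ‖)⁻¹ - (1 + t i * ‖ξ‖)⁻¹) * ‖realFourier f ξ‖ₑ ^ 2) := by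
          gcongr
          · refine (lintegral_maximalFn_sq_le _ hgm).trans ?_
            gcongr
            exact h₂ f hf hf2 _ _ hb hba
          · exact h₁ f hf hf2 _ _ hb hba
      _ = _ := by
          rw [hK, ENNReal.ofReal]
          push_cast
          ring
  calc _ ≤ ∑' i, K * ∫⁻ ξ, ENNReal.ofReal ((1 + t (i + 1) * ‖ξ‖)⁻¹ - (1 + t i * ‖ξ‖)⁻¹) *
        ‖realFourier f ξ‖ₑ ^ 2 := ENNReal.tsum_le_tsum hblock
    _ = K * ∫⁻ ξ, ∑' i, ENNReal.ofReal ((1 + t (i + 1) * ‖ξ‖)⁻¹ - (1 + t i * ‖ξ‖)⁻¹) *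
        ‖realFourier f ξ‖ₑ ^ 2 := by
        have mF : Measurable (realFourier f) := (continuous_realFourier hf).measurable
        rw [ENNReal.tsum_mul_left, lintegral_tsum fun i => by fun_prop]
    _ ≤ K * ∫⁻ ξ, ‖realFourier f ξ‖ₑ ^ 2 := by
        gcongr with ξ
        rw [ENNReal.tsum_mul_right]
        exact mul_le_of_le_one_left' (tsum_telescoping_le ht hanti (norm_nonneg ξ))
    _ = _ := by rw [lintegral_realFourier_sq hf hf2]

end OscillationL2

/-! ### The oscillation seminorm along a sequence of scales -/

section OscillationSeq

/-- The oscillation of a function of the scale along the sequence `t`. -/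
noncomputable def oscSeq (t : ℕ → ℝ) (G : ℝ → ℝ) : ℝ≥0∞ :=
  (∑' i, oscBlock (t (i + 1)) (t i) G) ^ (1 / 2 : ℝ)

lemma enorm_sub_le_oscBlock_rpow {b a : ℝ} (G : ℝ → ℝ) {ε δ : ℝ} (h : b ≤ δ ∧ δ < ε ∧ ε ≤ a) :
    ‖G ε - G δ‖ₑ ≤ oscBlock b a G ^ (1 / 2 : ℝ) := by
  have h1 : ‖G ε - G δ‖ₑ ^ (2 : ℝ) ≤ oscBlock b a G := by
    rw [ENNReal.rpow_two]
    exact le_iSup_of_le ε (le_iSup_of_le δ (le_iSup_of_le h le_rfl))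
  rw [one_div]
  exact (ENNReal.le_rpow_inv_iff (by norm_num)).2 h1

/-- Minkowski in ℓ². Assuming additivity of increments only lets terms independent of the scale
disappear. -/
lemma oscSeq_le_add {t : ℕ → ℝ} (ht : ∀ i, 0 < t i) {G H K : ℝ → ℝ}
    (h : ∀ s s', 0 < s → 0 < s' → G s - G s' = (H s - H s') + (K s - K s')) :
    oscSeq t G ≤ oscSeq t H + oscSeq t K := by
  set x : ℕ → ℝ≥0∞ := fun i => oscBlock (t (i + 1)) (t i) H ^ (1 / 2 : ℝ) with hx
  set y : ℕ → ℝ≥0∞ := fun i => oscBlock (t (i + 1)) (t i) K ^ (1 / 2 : ℝ) with hy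
  have hsq : ∀ z : ℝ≥0∞, (z ^ (1 / 2 : ℝ)) ^ (2 : ℝ) = z := fun z => by
    rw [← ENNReal.rpow_mul]; norm_num
  have hG : ∀ i, oscBlock (t (i + 1)) (t i) G ≤ (x i + y i) ^ (2 : ℝ) := by
    intro i
    refine iSup_le fun ε => iSup_le fun δ => iSup_le fun hεδ => ?_
    have hδ : 0 < δ := (ht _).trans_le hεδ.1
    rw [h ε δ (hδ.trans hεδ.2.1) hδ, ENNReal.rpow_two]
    gcongr
    exact (enorm_add_le _ _).trans (add_le_add (enorm_sub_le_oscBlock_rpow H hεδ)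
      (enorm_sub_le_oscBlock_rpow K hεδ))
  have hM := ENNReal.lintegral_Lp_add_le (μ := Measure.count) (f := x) (g := y) (p := 2)
    (measurable_of_countable _).aemeasurable (measurable_of_countable _).aemeasurable (by norm_num)
  simp only [lintegral_count, Pi.add_apply] at hM
  simp only [hx, hy, hsq] at hM
  refine le_trans ?_ hM
  exact ENNReal.rpow_le_rpow (ENNReal.tsum_le_tsum hG) (by norm_num)

/-- Each increment is at most the drop of U over its block; every drop is at most T and so is their
sum, so the squares sum to at most T². -/
lemma oscSeq_le_of_telescoping {t : ℕ → ℝ} (ht : ∀ i, 0 < t i) (hanti : Antitone t)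
    {G U : ℝ → ℝ} {T : ℝ} (hU : ∀ s, 0 < s → s ≤ t 0 → 0 ≤ U s ∧ U s ≤ T)
    (hG : ∀ δ ε, 0 < δ → δ ≤ ε → ε ≤ t 0 → |G ε - G δ| ≤ U δ - U ε) :
    oscSeq t G ≤ ENNReal.ofReal T := by
  have ht0 : ∀ i, t i ≤ t 0 := fun i => hanti (Nat.zero_le i)
  have hT : 0 ≤ T := (hU (t 0) (ht 0) le_rfl).1.trans (hU (t 0) (ht 0) le_rfl).2
  have hUanti : ∀ δ ε, 0 < δ → δ ≤ ε → ε ≤ t 0 → U ε ≤ U δ := fun δ ε h1 h2 h3 =>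
    sub_nonneg.1 ((abs_nonneg _).trans (hG δ ε h1 h2 h3))
  have hd : ∀ i, 0 ≤ U (t (i + 1)) - U (t i) := fun i =>
    sub_nonneg.2 (hUanti _ _ (ht _) (hanti (Nat.le_succ i)) (ht0 i))
  have hblock : ∀ i, oscBlock (t (i + 1)) (t i) G ≤
      ENNReal.ofReal T * ENNReal.ofReal (U (t (i + 1)) - U (t i)) := by
    intro i
    refine iSup_le fun ε => iSup_le fun δ => iSup_le fun h => ?_
    obtain ⟨h1, h2, h3⟩ := h
    have hδ : 0 < δ := (ht _).trans_le h1
    have hε : ε ≤ t 0 := h3.trans (ht0 i)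
    have h4 := hG δ ε hδ h2.le hε
    have h5 := hUanti _ _ (ht (i + 1)) h1 (h2.le.trans hε)
    have h6 := hUanti _ _ (hδ.trans h2) h3 (ht0 i)
    rw [enorm_sq_eq_ofReal, ← ENNReal.ofReal_mul hT]
    refine ENNReal.ofReal_le_ofReal ?_
    rw [← sq_abs]
    have h7 : |G ε - G δ| ≤ U (t (i + 1)) - U (t i) := by linarith
    have h8 : U (t (i + 1)) - U (t i) ≤ T := by
      linarith [(hU _ (ht (i + 1)) (ht0 _)).2, (hU _ (ht i) (ht0 _)).1]
    rw [sq]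
    exact mul_le_mul (h7.trans h8) h7 (abs_nonneg _) hT
  have hsum : ∑' i, ENNReal.ofReal (U (t (i + 1)) - U (t i)) ≤ ENNReal.ofReal T := by
    refine ENNReal.tsum_le_of_sum_range_le fun N => ?_
    rw [← ENNReal.ofReal_sum_of_nonneg fun i _ => hd i, Finset.sum_range_sub (fun i => U (t i))]
    refine ENNReal.ofReal_le_ofReal ?_
    linarith [(hU _ (ht N) (ht0 _)).2, (hU _ (ht 0) (ht0 _)).1]
  have h1 : ∑' i, oscBlock (t (i + 1)) (t i) G ≤ ENNReal.ofReal T ^ (2 : ℝ) := by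
    refine (ENNReal.tsum_le_tsum hblock).trans ?_
    rw [ENNReal.tsum_mul_left, ENNReal.rpow_two, sq]
    gcongr
  rw [oscSeq, one_div]
  exact (ENNReal.rpow_inv_le_iff (by norm_num)).2 h1

end OscillationSeq

/-! ### The contribution of functions supported far from the ball -/

section FarPart

variable {n : ℕ}

local notation "𝔼" => EuclideanSpace ℝ (Fin n)

/-- Away from z = 0 the scale derivative is bounded uniformly in s, so s ↦ φ_s(z) is Lipschitz down
to scale zero. -/
lemma exists_dilate_scale_sub_le (φ : 𝓢(𝔼, ℝ)) : ∃ C : ℝ, 0 < C ∧ ∀ (z : 𝔼) (δ ε : ℝ),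
    z ≠ 0 → 0 < δ → δ ≤ ε →
    |dilate φ ε z - dilate φ δ z| ≤ C * (ε - δ) * (‖z‖ ^ (n + 1))⁻¹ := by
  obtain ⟨C, hC, h⟩ := exists_dilate_le (scaleDeriv φ) 1
  refine ⟨C, hC, fun z δ ε hz hδ hε => ?_⟩
  have hz0 : 0 < ‖z‖ := norm_pos_iff.2 hz
  have := norm_image_sub_le_of_norm_deriv_le_segment' (f := fun s => dilate φ s z)
    (f' := fun s => s⁻¹ * dilate (scaleDeriv φ) s z) (a := δ) (b := ε)
    (C := C * (‖z‖ ^ (n + 1))⁻¹)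
    (fun s hs => (hasDerivAt_dilate φ z (hδ.trans_le hs.1)).hasDerivWithinAt) (fun s hs => ?_) ε
    (right_mem_Icc.2 hε)
  · rw [Real.norm_eq_abs] at this
    linarith
  · have hs0 : 0 < s := hδ.trans_le hs.1
    rw [norm_mul, norm_inv, Real.norm_eq_abs, Real.norm_eq_abs, abs_of_pos hs0]
    calc _ ≤ s⁻¹ * (C * (s ^ 1 * ((s + ‖z‖) ^ (n + 1))⁻¹)) := by gcongr; exact h s hs0 z
      _ = C * ((s + ‖z‖) ^ (n + 1))⁻¹ := by rw [pow_one]; field_simp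
      _ ≤ _ := by gcongr; linarith

/-- Differentiation in both scale and position gains r and leaves a constant times (2s +
ρ)^{-(n+2)}, which is dominated by the derivative of the right-hand side. The exact difference,
rather than its absolute size, is what allows telescoping. -/
lemma exists_dilate_mixed_sub_le (φ : 𝓢(𝔼, ℝ)) : ∃ C : ℝ, 0 < C ∧
    ∀ (c x y : 𝔼) (r δ ε : ℝ), x ∈ ball c r → 2 * r ≤ ‖c - y‖ → 0 < δ → δ ≤ ε →
    |(dilate φ ε (x - y) - dilate φ ε (c - y)) - (dilate φ δ (x - y) - dilate φ δ (c - y))| ≤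
      C * r * (((2 * δ + ‖c - y‖) ^ (n + 1))⁻¹ - ((2 * ε + ‖c - y‖) ^ (n + 1))⁻¹) := by
  obtain ⟨C, hC, h⟩ := exists_dilate_sub_le (scaleDeriv φ)
  refine ⟨C * 2 ^ (n + 1), by positivity, fun c x y r δ ε hx hy hδ hε => ?_⟩
  have hr : 0 < r := pos_of_mem_ball hx
  set ρ := ‖c - y‖ with hρ
  have hρ0 : 0 ≤ ρ := norm_nonneg _
  have hd : ∀ s, 0 < s → HasDerivAt (fun s => (dilate φ s (x - y) - dilate φ s (c - y)) -
      (dilate φ δ (x - y) - dilate φ δ (c - y)))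
      (s⁻¹ * dilate (scaleDeriv φ) s (x - y) - s⁻¹ * dilate (scaleDeriv φ) s (c - y)) s :=
    fun s hs => ((hasDerivAt_dilate φ (x - y) hs).sub (hasDerivAt_dilate φ (c - y) hs)).sub_const _
  have hB : ∀ s, 0 < s → HasDerivAt (fun s : ℝ => C * 2 ^ (n + 1) * r *
      (((2 * δ + ρ) ^ (n + 1))⁻¹ - ((2 * s + ρ) ^ (n + 1))⁻¹))
      (C * 2 ^ (n + 2) * r * ((n + 1) * ((2 * s + ρ) ^ (n + 2))⁻¹)) s := by
    intro s hs
    have hp : 0 < 2 * s + ρ := by positivity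
    have h1 : HasDerivAt (fun s : ℝ => 2 * s + ρ) 2 s := by
      simpa using ((hasDerivAt_id s).const_mul 2).add_const ρ
    have h2 := (((h1.pow (n + 1)).inv (pow_pos hp _).ne').const_sub
      (((2 * δ + ρ) ^ (n + 1))⁻¹)).const_mul (C * 2 ^ (n + 1) * r)
    refine h2.congr_deriv ?_
    simp only [Pi.pow_apply, Nat.add_sub_cancel]
    push_cast
    field_simp
    ring
  have hsub : segment ℝ (c - y) (x - y) ⊆ ball (c - y) r := by
    refine (convex_ball (c - y) r).segment_subset (mem_ball_self hr) ?_
    rw [mem_ball, dist_sub_right]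
    exact hx
  have hxc : ‖(x - y) - (c - y)‖ ≤ r := by
    rw [sub_sub_sub_cancel_right, ← dist_eq_norm]
    exact (mem_ball.1 hx).le
  -- Every point of the segment is within r ≤ ρ / 2 of c - y.
  have hR : ∀ w ∈ segment ℝ (c - y) (x - y), ρ / 2 ≤ ‖w‖ := by
    intro w hw
    have h1 := hsub hw
    rw [mem_ball, dist_eq_norm, norm_sub_rev] at h1
    have h2 := norm_sub_norm_le (c - y) w
    linarith
  have := image_norm_le_of_norm_deriv_right_le_deriv_boundary' (a := δ) (b := ε)
    (fun s hs => (hd s (hδ.trans_le hs.1)).continuousAt.continuousWithinAt)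
    (fun s hs => (hd s (hδ.trans_le hs.1)).hasDerivWithinAt) (by simp)
    (fun s hs => (hB s (hδ.trans_le hs.1)).continuousAt.continuousWithinAt)
    (fun s hs => (hB s (hδ.trans_le hs.1)).hasDerivWithinAt) (fun s hs => ?_)
    (right_mem_Icc.2 hε)
  · exact this
  · have hs0 : 0 < s := hδ.trans_le hs.1
    have h1 := h s hs0 (ρ / 2) (x - y) (c - y) (by positivity) hR
    rw [← mul_sub, norm_mul, norm_inv, Real.norm_eq_abs, Real.norm_eq_abs, abs_of_pos hs0]
    have e : s + ρ / 2 = (2 * s + ρ) / 2 := by ring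
    have hp : 0 < 2 * s + ρ := by positivity
    calc _ ≤ s⁻¹ * (C * r * (s ^ 2 * ((s + ρ / 2) ^ (n + 3))⁻¹)) := by
          gcongr
          exact h1.trans (by gcongr)
      _ = C * 2 ^ (n + 2) * r * ((2 * s + ρ) ^ (n + 2))⁻¹ * (2 * s / (2 * s + ρ)) := by
          rw [e, div_pow, inv_div, pow_succ _ (n + 2), pow_succ (2 * s + ρ) (n + 2)]
          field_simp
      _ ≤ C * 2 ^ (n + 2) * r * ((2 * s + ρ) ^ (n + 2))⁻¹ * 1 := by
          gcongr
          rw [div_le_one hp]; linarith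
      _ ≤ _ := by
          rw [mul_one]
          gcongr
          refine le_mul_of_one_le_left (by positivity) ?_
          linarith [Nat.cast_nonneg (α := ℝ) n]

lemma two_pow_inv_weight_le {r ρ s : ℝ} (hr : 0 < r) (hs : 0 ≤ s) (hρ : 2 * r ≤ ρ) (k : ℕ) :
    ((2 * s + ρ) ^ k)⁻¹ ≤ 2 ^ k * ((2 * r + ρ) ^ k)⁻¹ := by
  have h1 : 0 < 2 * s + ρ := by linarith
  have h2 : 0 < 2 * r + ρ := by linarith
  rw [← inv_pow, ← inv_pow, ← mul_pow]
  gcongr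
  rw [inv_le_iff_one_le_mul₀ h1, mul_assoc, ← div_eq_inv_mul, ← mul_div_assoc, le_div_iff₀ h2]
  linarith

/-- The weighted integral which controls the contribution of a function `v` supported far from `c`. -/
noncomputable def farIntegral (v : 𝔼 → ℝ) (c : 𝔼) (r : ℝ) : ℝ :=
  ∫ y, ((2 * r + ‖c - y‖) ^ (n + 1))⁻¹ * ‖v y‖

lemma farIntegral_nonneg (v : 𝔼 → ℝ) (c : 𝔼) {r : ℝ} (hr : 0 < r) : 0 ≤ farIntegral v c r :=
  integral_nonneg fun y => by positivity

/-- Only finiteness is at stake, so the bound, obtained from U(s) = Q (t 0 - s), may depend on the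
sequence. -/
lemma oscSeq_convOp_center_ne_top (φ : 𝓢(𝔼, ℝ)) {t : ℕ → ℝ} (ht : ∀ i, 0 < t i)
    (hanti : Antitone t) {v : 𝔼 → ℝ} (hv : TailIntegrable v) {c : 𝔼} {r : ℝ} (hr : 0 < r)
    (hsupp : ∀ y ∈ ball c (2 * r), v y = 0) :
    oscSeq t (fun s => convOp φ s v c) ≠ ∞ := by
  obtain ⟨C, hC, h⟩ := exists_dilate_scale_sub_le φ
  set Q := C * 2 ^ (n + 1) * farIntegral v c r with hQ
  have hQ0 : 0 ≤ Q := mul_nonneg (by positivity) (farIntegral_nonneg v c hr)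
  refine ne_top_of_le_ne_top ENNReal.ofReal_ne_top (oscSeq_le_of_telescoping ht hanti
    (U := fun s => Q * (t 0 - s)) (T := Q * t 0) (fun s hs hs0 => ⟨?_, ?_⟩) fun δ ε hδ hε hε0 => ?_)
  · exact mul_nonneg hQ0 (by linarith)
  · gcongr; linarith
  · have hε' := hδ.trans_le hε
    have i1 := hv.integrable_dilate_mul φ hε' c
    have i2 := hv.integrable_dilate_mul φ hδ c
    have i3 := hv.integrable_weight (mul_pos two_pos hr) c
    simp only [convOp_apply]
    rw [← integral_sub i1 i2]
    have e : Q * (t 0 - δ) - Q * (t 0 - ε) = ∫ y, C * (ε - δ) * 2 ^ (n + 1) *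
        (((2 * r + ‖c - y‖) ^ (n + 1))⁻¹ * ‖v y‖) := by
      rw [integral_const_mul, hQ, farIntegral]; ring
    rw [e]
    rw [← Real.norm_eq_abs]
    refine norm_integral_le_of_norm_le (i3.const_mul _) (Eventually.of_forall fun y => ?_)
    by_cases hy : y ∈ ball c (2 * r)
    · simp [hsupp y hy]
    · rw [mem_ball, dist_comm, dist_eq_norm, not_lt] at hy
      have hz : c - y ≠ 0 := by
        intro h0
        rw [h0, norm_zero] at hy; linarith
      rw [← sub_mul, norm_mul, ← mul_assoc]
      gcongr
      refine (h (c - y) δ ε hz hδ hε).trans ?_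
      rw [mul_assoc (C * (ε - δ))]
      have := two_pow_inv_weight_le hr le_rfl hy (n + 1)
      rw [mul_zero, zero_add] at this
      have : 0 ≤ ε - δ := by linarith
      gcongr

/-- Telescoping with U(s) = C r `farIntegral v c s`. As v vanishes on the doubled ball, U(s) is at
most 2^{n+1} times the value at s = r, uniformly in s and in the sequence. -/
lemma exists_oscSeq_convOp_sub_le (φ : 𝓢(𝔼, ℝ)) : ∃ C : ℝ, 0 < C ∧
    ∀ t : ℕ → ℝ, (∀ i, 0 < t i) → Antitone t → ∀ (v : 𝔼 → ℝ), TailIntegrable v →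
      ∀ (c x : 𝔼) (r : ℝ), x ∈ ball c r → (∀ y ∈ ball c (2 * r), v y = 0) →
      oscSeq t (fun s => convOp φ s v x - convOp φ s v c) ≤
        ENNReal.ofReal (C * r * farIntegral v c r) := by
  obtain ⟨C, hC, h⟩ := exists_dilate_mixed_sub_le φ
  refine ⟨C * 2 ^ (n + 1), by positivity, fun t ht hanti v hv c x r hx hsupp => ?_⟩
  have hr : 0 < r := pos_of_mem_ball hx
  have hout : ∀ y, y ∉ ball c (2 * r) → 2 * r ≤ ‖c - y‖ := fun y hy => by
    rwa [mem_ball, dist_comm, dist_eq_norm, not_lt] at hy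
  have hw : ∀ s, 0 < s → Integrable fun y => ((2 * s + ‖c - y‖) ^ (n + 1))⁻¹ * ‖v y‖ :=
    fun s hs => hv.integrable_weight (mul_pos two_pos hs) c
  refine oscSeq_le_of_telescoping ht hanti
    (U := fun s => C * r * farIntegral v c s) (fun s hs _ => ⟨?_, ?_⟩) fun δ ε hδ hε _ => ?_
  · exact mul_nonneg (by positivity) (farIntegral_nonneg v c hs)
  · have e : C * 2 ^ (n + 1) * r * farIntegral v c r =
        C * r * ∫ y, 2 ^ (n + 1) * (((2 * r + ‖c - y‖) ^ (n + 1))⁻¹ * ‖v y‖) := by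
      rw [integral_const_mul, farIntegral]; ring
    rw [e]
    gcongr
    refine integral_mono (hw s hs) ((hw r hr).const_mul _) fun y => ?_
    simp only
    by_cases hy : y ∈ ball c (2 * r)
    · simp [hsupp y hy]
    · rw [← mul_assoc]
      gcongr
      exact two_pow_inv_weight_le hr hs.le (hout y hy) (n + 1)
  · have hε' := hδ.trans_le hε
    have i1 := hv.integrable_dilate_mul φ hε' x
    have i2 := hv.integrable_dilate_mul φ hε' c
    have i3 := hv.integrable_dilate_mul φ hδ x
    have i4 := hv.integrable_dilate_mul φ hδ c
    simp only [convOp_apply, farIntegral]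
    have j1 : Integrable fun y => dilate φ ε (x - y) * v y - dilate φ ε (c - y) * v y := i1.sub i2
    have j2 : Integrable fun y => dilate φ δ (x - y) * v y - dilate φ δ (c - y) * v y := i3.sub i4
    rw [← integral_sub i1 i2, ← integral_sub i3 i4, ← integral_sub j1 j2,
      ← mul_sub, ← integral_sub (hw δ hδ) (hw ε hε'), ← integral_const_mul]
    rw [← Real.norm_eq_abs]
    refine norm_integral_le_of_norm_le (((hw δ hδ).sub (hw ε hε')).const_mul _)
      (Eventually.of_forall fun y => ?_)
    by_cases hy : y ∈ ball c (2 * r)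
    · simp [hsupp y hy]
    · rw [← sub_mul, ← sub_mul, ← sub_mul, norm_mul, ← sub_mul, ← mul_assoc]
      gcongr
      exact h c x y r δ ε hx (hout y hy) hδ hε

end FarPart

/-! ### Assembly of the local and far estimates -/

section Main

variable {n : ℕ}

local notation "𝔼" => EuclideanSpace ℝ (Fin n)

/-- The weighted estimate on the unit ball at the origin; this yields absolute convergence of all
the convolutions. -/
lemma MemBMO.tailIntegrable {f : 𝔼 → ℝ} (hf : MemBMO f) : TailIntegrable f := by
  set m := ⨍ z in ball (0 : 𝔼) 1, f z with hm
  have h : TailIntegrable fun y => f y - m := by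
    refine ⟨((by fun_prop (disch := intros; positivity) :
      Continuous fun y : 𝔼 => ((1 + ‖y‖) ^ (n + 1))⁻¹).aestronglyMeasurable.mul
        (hf.1.aestronglyMeasurable.sub aestronglyMeasurable_const)), ?_⟩
    have h1 := lintegral_sub_average_mul_inv_pow_le hf.1 0 one_pos
    refine lt_of_le_of_lt (le_of_eq ?_) (h1.trans_lt ?_)
    · refine lintegral_congr fun y => ?_
      rw [enorm_mul, mul_comm, sub_zero,
        Real.enorm_of_nonneg (r := ((1 + ‖y‖) ^ (n + 1))⁻¹) (by positivity)]
    · exact ENNReal.mul_lt_top (ENNReal.mul_lt_top bmoTailConst_ne_top.lt_top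
        ENNReal.ofReal_lt_top) hf.2
  refine (h.add (tailIntegrable_const m)).congr (Eventually.of_forall fun y => ?_)
  simp

lemma lintegral_rpow_half_le {μ : Measure 𝔼} {F : 𝔼 → ℝ≥0∞} (hF : Measurable F) :
    ∫⁻ x, F x ^ (1 / 2 : ℝ) ∂μ ≤ (∫⁻ x, F x ∂μ) ^ (1 / 2 : ℝ) * μ univ ^ (1 / 2 : ℝ) := by
  have h := ENNReal.lintegral_mul_le_Lp_mul_Lq μ (p := 2) (q := 2)
    Real.HolderConjugate.two_two (f := fun x => F x ^ (1 / 2 : ℝ)) (g := fun _ => 1)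
    (hF.pow_const _).aemeasurable aemeasurable_const
  have hsq : ∀ z : ℝ≥0∞, (z ^ (1 / 2 : ℝ)) ^ (2 : ℝ) = z := fun z => by
    rw [← ENNReal.rpow_mul]; norm_num
  simp only [Pi.mul_apply, mul_one, hsq, ENNReal.one_rpow, lintegral_const, one_mul] at h
  exact h

/-- Cauchy–Schwarz on the ball, the L² oscillation bound on the whole space, then John–Nirenberg on
the doubled ball. -/
lemma exists_lintegral_oscSeq_local_le (φ : 𝓢(𝔼, ℝ)) (hφ : ∫ x, φ x = 1) : ∃ D : ℝ≥0,
    ∀ t : ℕ → ℝ, (∀ i, 0 < t i) → Antitone t → ∀ f : 𝔼 → ℝ, MemBMO f → ∀ (c : 𝔼) (r : ℝ), 0 < r →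
      ∫⁻ x in ball c r, oscSeq t (fun s => convOp φ s ((ball c (2 * r)).indicator
        fun y => f y - ⨍ z in ball c (2 * r), f z) x) ≤ D * bmoNorm f * volume (ball c r) := by
  obtain ⟨D, hD⟩ := exists_lintegral_oscillation_sq_le φ hφ
  refine ⟨(D * 3 * 2 ^ n) ^ (1 / 2 : ℝ) * (16 * 20 ^ n), fun t ht hanti f hf c r hr => ?_⟩
  have hr2 : 0 < 2 * r := by positivity
  set B := ball c (2 * r) with hB
  set f₂ : 𝔼 → ℝ := B.indicator fun y => f y - ⨍ z in B, f z with hf₂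
  have hJN := lintegral_sq_sub_average_le hf.1 hf.2.ne c hr2
  have h2 : ∫⁻ x, ‖f₂ x‖ₑ ^ 2 = ∫⁻ x in B, ‖f x - ⨍ z in B, f z‖ₑ ^ 2 := by
    rw [← lintegral_indicator (s := B) measurableSet_ball]
    refine lintegral_congr fun x => ?_
    by_cases hx : x ∈ B <;> simp [hf₂, hx]
  have hi : Integrable f₂ := by
    rw [hf₂, integrable_indicator_iff measurableSet_ball]
    exact (integrableOn_ball hf.1 c _).sub (integrableOn_const (volume_ball_ne_top c))
  have hfin : ∫⁻ x, ‖f₂ x‖ₑ ^ 2 < ∞ := by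
    rw [h2]
    refine hJN.trans_lt (ENNReal.mul_lt_top ?_ measure_ball_lt_top)
    have := hf.2
    finiteness
  have hL2 : MemLp f₂ 2 := by
    refine ⟨hi.1, ?_⟩
    have := eLpNorm_nnreal_pow_eq_lintegral (f := f₂) (μ := volume) (p := 2) (by norm_num)
    norm_num at this
    rw [← this] at hfin
    exact (ENNReal.pow_lt_top_iff.1 hfin).resolve_right (by norm_num)
  have hm : Measurable fun x =>
      ∑' i, oscBlock (t (i + 1)) (t i) (fun s => convOp φ s f₂ x) :=
    Measurable.tsum fun i =>
      measurable_oscBlock_convOp φ (ht (i + 1)) (TailIntegrable.of_integrable hi)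
  have key := hD t ht hanti f₂ hi hL2
  have hV : volume B = 2 ^ n * volume (ball c r) := by
    rw [hB, volume_ball_mul c c hr two_pos, ENNReal.ofReal_pow (by norm_num), ENNReal.ofReal_ofNat]
  calc ∫⁻ x in ball c r, oscSeq t (fun s => convOp φ s f₂ x)
      ≤ (∫⁻ x in ball c r, ∑' i, oscBlock (t (i + 1)) (t i) (fun s => convOp φ s f₂ x)) ^
          (1 / 2 : ℝ) * volume (ball c r) ^ (1 / 2 : ℝ) := by
        have := lintegral_rpow_half_le (μ := volume.restrict (ball c r)) hm
        rwa [Measure.restrict_apply_univ] at this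
    _ ≤ (D * (3 * (16 * 20 ^ n * bmoNorm f) ^ 2 * (2 ^ n * volume (ball c r)))) ^ (1 / 2 : ℝ) *
          volume (ball c r) ^ (1 / 2 : ℝ) := by
        gcongr
        refine (setLIntegral_le_lintegral _ _).trans (key.trans ?_)
        gcongr
        rw [h2, ← hV]
        exact hJN
    _ = ((D * 3 * 2 ^ n) * (16 * 20 ^ n * bmoNorm f) ^ 2 * volume (ball c r)) ^ (1 / 2 : ℝ) *
          volume (ball c r) ^ (1 / 2 : ℝ) := by
        congr 2; ring
    _ = _ := by
        rw [ENNReal.mul_rpow_of_nonneg _ _ (by norm_num), ENNReal.mul_rpow_of_nonneg _ _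
          (by norm_num), mul_assoc, ← ENNReal.rpow_add_of_nonneg _ _ (by norm_num) (by norm_num),
          ← ENNReal.rpow_two, ← ENNReal.rpow_mul, ENNReal.coe_mul,
          ENNReal.coe_rpow_of_nonneg _ (by norm_num)]
        push_cast
        norm_num
        ring

lemma exists_farIntegral_le : ∃ D : ℝ≥0, ∀ f : 𝔼 → ℝ, MemBMO f → ∀ (c : 𝔼) (r : ℝ), 0 < r →
    ENNReal.ofReal (r * farIntegral ((ball c (2 * r))ᶜ.indicator
      fun y => f y - ⨍ z in ball c (2 * r), f z) c r) ≤ D * bmoNorm f := by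
  refine ⟨(bmoTailConst n).toNNReal, fun f hf c r hr => ?_⟩
  rw [ENNReal.coe_toNNReal bmoTailConst_ne_top, ENNReal.ofReal_mul hr.le]
  have hr2 : 0 < 2 * r := by positivity
  set m := ⨍ z in ball c (2 * r), f z with hm
  have h1 : ENNReal.ofReal (farIntegral ((ball c (2 * r))ᶜ.indicator fun y => f y - m) c r) ≤
      bmoTailConst n * ENNReal.ofReal (2 * r)⁻¹ * bmoNorm f := by
    rw [farIntegral]
    refine (Real.ofReal_le_enorm _).trans ((enorm_integral_le_lintegral_enorm _).trans
      (le_trans ?_ (lintegral_sub_average_mul_inv_pow_le hf.1 c hr2)))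
    refine lintegral_mono fun y => ?_
    rw [enorm_mul, mul_comm, enorm_norm, norm_sub_rev,
      Real.enorm_of_nonneg (r := ((2 * r + ‖y - c‖) ^ (n + 1))⁻¹) (by positivity)]
    gcongr
    exact enorm_indicator_le_enorm_self _ _
  calc _ ≤ ENNReal.ofReal r * (bmoTailConst n * ENNReal.ofReal (2 * r)⁻¹ * bmoNorm f) := by gcongr
    _ = (ENNReal.ofReal r * ENNReal.ofReal (2 * r)⁻¹) * (bmoTailConst n * bmoNorm f) := by ring
    _ ≤ 1 * (bmoTailConst n * bmoNorm f) := by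
        gcongr
        rw [← ENNReal.ofReal_mul hr.le, ENNReal.ofReal_le_one]
        rw [← div_eq_mul_inv, div_le_one hr2]; linarith
    _ = _ := one_mul _

lemma oscSeq_neg (t : ℕ → ℝ) (G : ℝ → ℝ) : oscSeq t (fun s => -G s) = oscSeq t G := by
  simp only [oscSeq, oscBlock]
  congr 1
  refine tsum_congr fun i => ?_
  refine iSup_congr fun ε => iSup_congr fun δ => iSup_congr fun _ => ?_
  rw [neg_sub_neg, enorm_sub_rev]

/-- On every ball, the oscillation differs from a finite constant by a function of controlled
mean. -/
lemma exists_oscillation_ball_estimate (φ : 𝓢(𝔼, ℝ)) (hφ : ∫ x, φ x = 1) : ∃ D : ℝ≥0,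
    ∀ t : ℕ → ℝ, (∀ i, 0 < t i) → Antitone t → ∀ f : 𝔼 → ℝ, MemBMO f → ∀ (c : 𝔼) (r : ℝ), 0 < r →
      ∃ (a : ℝ≥0∞) (v : 𝔼 → ℝ≥0∞), a ≠ ∞ ∧ Measurable v ∧
        (∀ x ∈ ball c r, oscillationOp (convOp φ) t f x ≤ v x + a ∧
          a ≤ oscillationOp (convOp φ) t f x + v x) ∧
        ∫⁻ x in ball c r, v x ≤ D * bmoNorm f * volume (ball c r) := by
  obtain ⟨D₁, h₁⟩ := exists_lintegral_oscSeq_local_le φ hφ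
  obtain ⟨D₂, h₂⟩ := exists_farIntegral_le (n := n)
  obtain ⟨C, hC, h₃⟩ := exists_oscSeq_convOp_sub_le φ
  refine ⟨D₁ + C.toNNReal * D₂, fun t ht hanti f hf c r hr => ?_⟩
  set B := ball c (2 * r) with hB
  set m := ⨍ z in B, f z with hm
  set f₂ : 𝔼 → ℝ := B.indicator fun y => f y - m with hf₂
  set f₃ : 𝔼 → ℝ := Bᶜ.indicator fun y => f y - m with hf₃
  have htail : TailIntegrable fun y => f y - m := hf.tailIntegrable.sub (tailIntegrable_const m)
  have t2 : TailIntegrable f₂ := by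
    refine (Integrable.indicator htail measurableSet_ball (s := B)).congr
      (Eventually.of_forall fun y => ?_)
    by_cases hy : y ∈ B <;> simp [hf₂, hy]
  have t3 : TailIntegrable f₃ := by
    refine (Integrable.indicator htail measurableSet_ball.compl (s := Bᶜ)).congr
      (Eventually.of_forall fun y => ?_)
    by_cases hy : y ∈ B <;> simp [hf₃, hy]
  have hsupp : ∀ y ∈ B, f₃ y = 0 := fun y hy => by simp [hf₃, hy]
  have hdec : ∀ s, 0 < s → ∀ x, convOp φ s f x = m + convOp φ s f₂ x + convOp φ s f₃ x := by
    intro s hs x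
    have e : f = fun y => m + (f₂ y + f₃ y) := by
      ext y
      by_cases hy : y ∈ B <;> simp [hf₂, hf₃, hy]
    conv_lhs => rw [e]
    rw [convOp_add φ hs (tailIntegrable_const m) (t2.add t3), convOp_add φ hs t2 t3,
      convOp_const _ hs, hφ, one_mul, add_assoc]
  set K : ℝ≥0∞ := C.toNNReal * (D₂ * bmoNorm f) with hK
  have hfar : ∀ x ∈ ball c r, oscSeq t (fun s => convOp φ s f₃ x - convOp φ s f₃ c) ≤ K := by
    intro x hx
    refine (h₃ t ht hanti f₃ t3 c x r hx hsupp).trans ?_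
    rw [mul_assoc, ENNReal.ofReal_mul hC.le, hK, ENNReal.ofReal]
    gcongr
    exact h₂ f hf c r hr
  have hm2 : Measurable fun x => oscSeq t (fun s => convOp φ s f₂ x) :=
    (Measurable.tsum fun i =>
      measurable_oscBlock_convOp φ (ht (i + 1)) t2).pow_const _
  -- The constant is the oscillation of the far part at the centre; the error v is the local
  -- oscillation plus the uniform far bound K.
  refine ⟨oscSeq t (fun s => convOp φ s f₃ c),
    fun x => oscSeq t (fun s => convOp φ s f₂ x) + K,
    oscSeq_convOp_center_ne_top φ ht hanti t3 hr hsupp, hm2.add_const K, fun x hx => ⟨?_, ?_⟩, ?_⟩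
  · calc oscillationOp (convOp φ) t f x = oscSeq t (fun s => convOp φ s f x) := rfl
      _ ≤ oscSeq t (fun s => convOp φ s f₂ x) + oscSeq t (fun s => convOp φ s f₃ x) :=
          oscSeq_le_add ht fun s s' hs hs' => by rw [hdec s hs, hdec s' hs']; ring
      _ ≤ oscSeq t (fun s => convOp φ s f₂ x) +
          (oscSeq t (fun s => convOp φ s f₃ x - convOp φ s f₃ c) +
            oscSeq t (fun s => convOp φ s f₃ c)) := by
          gcongr
          exact oscSeq_le_add ht fun s s' hs hs' => by ring
      _ ≤ oscSeq t (fun s => convOp φ s f₂ x) + (K + oscSeq t (fun s => convOp φ s f₃ c)) := by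
          gcongr
          exact hfar x hx
      _ = _ := by ring
  · have hneg : oscSeq t (fun s => -(convOp φ s f₃ x - convOp φ s f₃ c)) ≤ K :=
      (oscSeq_neg t _).le.trans (hfar x hx)
    have hneg2 : oscSeq t (fun s => -convOp φ s f₂ x) = oscSeq t (fun s => convOp φ s f₂ x) :=
      oscSeq_neg t _
    calc oscSeq t (fun s => convOp φ s f₃ c)
        ≤ oscSeq t (fun s => convOp φ s f₃ x) +
          oscSeq t (fun s => -(convOp φ s f₃ x - convOp φ s f₃ c)) :=
          oscSeq_le_add ht fun s s' hs hs' => by ring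
      _ ≤ (oscSeq t (fun s => convOp φ s f x) + oscSeq t (fun s => -convOp φ s f₂ x)) + K := by
          gcongr
          exact oscSeq_le_add ht fun s s' hs hs' => by rw [hdec s hs, hdec s' hs']; ring
      _ = oscillationOp (convOp φ) t f x + (oscSeq t (fun s => convOp φ s f₂ x) + K) := by
          rw [hneg2, add_assoc]; rfl
  · rw [lintegral_add_right _ measurable_const, setLIntegral_const]
    calc _ ≤ D₁ * bmoNorm f * volume (ball c r) + K * volume (ball c r) := by
          gcongr
          exact h₁ t ht hanti f hf c r hr
      _ = _ := by
          rw [hK]; push_cast; ring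

lemma enorm_toReal_sub_toReal_le {u a v : ℝ≥0∞} (hu : u ≠ ∞) (ha : a ≠ ∞) (h1 : u ≤ v + a)
    (h2 : a ≤ u + v) : ‖u.toReal - a.toReal‖ₑ ≤ v := by
  rcases eq_or_ne v ∞ with rfl | hv
  · exact le_top
  rw [Real.enorm_eq_ofReal_abs, ENNReal.ofReal_le_iff_le_toReal hv, abs_le]
  have e1 := ENNReal.toReal_mono (by finiteness) h1
  have e2 := ENNReal.toReal_mono (by finiteness) h2
  rw [ENNReal.toReal_add hv ha] at e1
  rw [ENNReal.toReal_add hu hv] at e2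
  exact ⟨by linarith, by linarith⟩

end Main

theorem mainTheorem5 (n : ℕ) (φ : 𝓢(EuclideanSpace ℝ (Fin n), ℝ)) (hφ : ∫ x, φ x = 1) :
    ∃ C : ℝ≥0, 0 < C ∧
      ∀ t : ℕ → ℝ, (∀ i, 0 < t i) → Antitone t → Tendsto t atTop (𝓝 0) →
        ∀ f : EuclideanSpace ℝ (Fin n) → ℝ, MemBMO f →
          (∀ s : ℝ, 0 < s →
            ConvolutionExists (dilate φ s) f (ContinuousLinearMap.lsmul ℝ ℝ) volume) ∧
          (∀ᵐ x, oscillationOp (convOp φ) t f x < ∞) ∧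
          MemBMO (fun x => (oscillationOp (convOp φ) t f x).toReal) ∧
          bmoNorm (fun x => (oscillationOp (convOp φ) t f x).toReal) ≤ C * bmoNorm f := by
  obtain ⟨D, hD⟩ := exists_oscillation_ball_estimate φ hφ
  -- The factor 2 pays for replacing the mean by the constant a; the 1 only ensures positivity.
  refine ⟨2 * D + 1, by positivity, fun t ht hanti _ f hf => ?_⟩
  have htail := hf.tailIntegrable
  have hm : Measurable fun x => oscillationOp (convOp φ) t f x :=
    (Measurable.tsum fun i =>
      measurable_oscBlock_convOp φ (ht (i + 1)) htail).pow_const _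
  have hball : ∀ (c : EuclideanSpace ℝ (Fin n)) (r : ℝ), 0 < r →
      ∫⁻ x in ball c r, oscillationOp (convOp φ) t f x < ∞ := by
    intro c r hr
    obtain ⟨a, v, ha, -, hv, hint⟩ := hD t ht hanti f hf c r hr
    calc ∫⁻ x in ball c r, oscillationOp (convOp φ) t f x ≤ ∫⁻ x in ball c r, (v x + a) :=
          setLIntegral_mono' measurableSet_ball fun x hx => (hv x hx).1
      _ = (∫⁻ x in ball c r, v x) + a * volume (ball c r) := by
          rw [lintegral_add_right _ measurable_const, setLIntegral_const]
      _ < ∞ := by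
          refine ENNReal.add_lt_top.2 ⟨hint.trans_lt ?_, ENNReal.mul_lt_top ha.lt_top
            measure_ball_lt_top⟩
          exact ENNReal.mul_lt_top (ENNReal.mul_lt_top ENNReal.coe_lt_top hf.2)
            measure_ball_lt_top
  -- Finite integrals over balls exhausting the space give finiteness almost everywhere.
  have hae : ∀ᵐ x, oscillationOp (convOp φ) t f x < ∞ := by
    have h : ∀ N : ℕ, ∀ᵐ x, x ∈ ball (0 : EuclideanSpace ℝ (Fin n)) (N + 1) →
        oscillationOp (convOp φ) t f x < ∞ := fun N =>
      (ae_restrict_iff' measurableSet_ball).1 (ae_lt_top hm (hball 0 _ (by positivity)).ne)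
    filter_upwards [ae_all_iff.2 h] with x hx
    obtain ⟨N, hN⟩ := exists_nat_gt ‖x‖
    exact hx N (by rw [mem_ball_zero_iff]; linarith)
  have hloc : LocallyIntegrable fun x => (oscillationOp (convOp φ) t f x).toReal := by
    refine fun x => ⟨ball x 1, ball_mem_nhds x one_pos, hm.ennreal_toReal.aestronglyMeasurable, ?_⟩
    refine lt_of_le_of_lt (lintegral_mono fun y => ?_) (hball x 1 one_pos)
    rw [Real.enorm_of_nonneg ENNReal.toReal_nonneg]
    exact ENNReal.ofReal_toReal_le
  have hbd : bmoNorm (fun x => (oscillationOp (convOp φ) t f x).toReal) ≤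
      2 * (D * bmoNorm f) := by
    refine bmoNorm_le_of_forall_ball hloc fun c r hr => ?_
    obtain ⟨a, v, ha, -, hv, hint⟩ := hD t ht hanti f hf c r hr
    refine ⟨a.toReal, le_trans (setLIntegral_mono_ae' measurableSet_ball ?_) hint⟩
    filter_upwards [hae] with x hx hxB
    exact enorm_toReal_sub_toReal_le hx.ne ha (hv x hxB).1 (hv x hxB).2
  refine ⟨fun s hs => htail.convolutionExists φ hs, hae, ⟨hloc, hbd.trans_lt ?_⟩, hbd.trans ?_⟩
  · exact ENNReal.mul_lt_top (by norm_num) (ENNReal.mul_lt_top ENNReal.coe_lt_top hf.2)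
  · push_cast
    rw [add_mul, one_mul, mul_assoc]
    exact le_self_add
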